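/- For an almost disjoint family $\mathcal A$ (a family of infinite subsets of $\omega$ such that $A\cap B$ is finite for all distinct $A,B\in\mathcal A$), let $K_{\mathcal A}=\omega\cup\mathcal A\cup\{\infty\}$ be the one-point compactification of the locally compact space $\omega\cup\mathcal A$ (disjoint union) in which the points of $\omega$ are isolated and the basic open neighbourhoods of a point $A\in\mathcal A$ are the sets $\{A\}\cup(A\setminus F)$ with $F\subseteq\omega$ finite. Let $C(K_{\mathcal A})$ be the Banach space of continuous real-valued functions on $K_{\mathcal A}$ with the supremum norm, and write $X\simeq Y$ if the Banach spaces $X$ and $Y$ are isomorphic, that is, linearly homeomorphic. For a cardinal $\kappa$, let $\mathsf{MA}(\kappa)$ denote Martin's axiom: for every nonempty partial order $P$ satisfying the countable chain condition and every family of at most $\kappa$ dense subsets of $P$ there is a filter in $P$ that meets every member of the family. **Theorem.** (a) Under $\mathsf{MA}(\kappa)$, if $\mathcal A$ and $\mathcal B$ are almost disjoint families with $|\mathcal A|=|\mathcal B|=\kappa$, then $C(K_{\mathcal A})\simeq C(K_{\mathcal B})$. (b) Under $\mathsf{MA}(\kappa)$, if $\mathcal A$ is an almost disjoint family with $|\mathcal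 A|=\kappa$, then $C(K_{\mathcal A})\simeq C(K_{\mathcal A})\oplus C(K_{\mathcal A})$. (c) (Without additional set-theoretic assumptions.) There are $2^{\mathfrak c}$ almost disjoint families $\mathcal A$ of cardinality $\mathfrak c$ for which the spaces $C(K_{\mathcal A})$ are pairwise nonisomorphic. -/

import Mathlib

open scoped Cardinal

/-- A family of infinite subsets of `ℕ`, any two distinct members of which have finite
intersection. -/
def AlmostDisjoint (𝒜 : Set (Set ℕ)) : Prop :=
  (∀ A ∈ 𝒜, A.Infinite) ∧ 𝒜.Pairwise fun A B => (A ∩ B).Finite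

/-- The underlying set `ω ∪ {A : A ∈ 𝒜}` (a disjoint union) of the locally compact space attached
to a family `𝒜`. -/
inductive PsiSpace (𝒜 : Set (Set ℕ)) : Type
  | nat (n : ℕ) : PsiSpace 𝒜
  | pt (A : 𝒜) : PsiSpace 𝒜

/-- A set `U` is open iff for every `A ∈ 𝒜` that belongs to `U` as a point, `U` contains
`A \ F` for some finite `F ⊆ ω`. So the points of `ω` are isolated, and the sets
`{A} ∪ (A \ F)` with `F` finite form a base of open neighbourhoods at the point `A`. -/
instance PsiSpace.instTopologicalSpace (𝒜 : Set (Set ℕ)) : TopologicalSpace (PsiSpace 𝒜) where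
  IsOpen U := ∀ A : 𝒜, PsiSpace.pt A ∈ U → {n ∈ (A : Set ℕ) | PsiSpace.nat n ∉ U}.Finite
  isOpen_univ := by
    intro A _
    simp
  isOpen_inter := by
    intro U V hU hV A hA
    refine ((hU A hA.1).union (hV A hA.2)).subset ?_
    rintro n ⟨hn, hnot⟩
    by_cases h : PsiSpace.nat n ∈ U
    · exact Or.inr ⟨hn, fun h' => hnot ⟨h, h'⟩⟩
    · exact Or.inl ⟨hn, h⟩
  isOpen_sUnion := by
    rintro S hS A ⟨U, hU, hA⟩
    refine (hS U hU A hA).subset ?_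
    rintro n ⟨hn, hnot⟩
    exact ⟨hn, fun h => hnot ⟨U, hU, h⟩⟩

/-- The compact space `K_𝒜`: the one-point compactification of `ω ∪ 𝒜`. -/
abbrev KSpace (𝒜 : Set (Set ℕ)) : Type := OnePoint (PsiSpace 𝒜)

/-- Isomorphism of Banach spaces: a linear homeomorphism, not necessarily isometric. -/
def BanachIso (X Y : Type) [NormedAddCommGroup X] [NormedSpace ℝ X]
    [NormedAddCommGroup Y] [NormedSpace ℝ Y] : Prop :=
  Nonempty (X ≃L[ℝ] Y)

/-- The countable chain condition: every set of pairwise incompatible elements is countable. -/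
def CountableChainCondition (P : Type) [PartialOrder P] : Prop :=
  ∀ S : Set P, (S.Pairwise fun p q => ¬ ∃ r, r ≤ p ∧ r ≤ q) → S.Countable

/-- A set `D` is dense in `P` if below every element of `P` there is an element of `D`. -/
def DenseBelow {P : Type} [PartialOrder P] (D : Set P) : Prop :=
  ∀ p : P, ∃ d ∈ D, d ≤ p

/-- Martin's axiom `MA(κ)`: for every nonempty ccc partial order and every family of at most `κ`
dense sets there is a filter that meets all of them. -/
def MartinAxiom (κ : Cardinal.{0}) : Prop :=
  ∀ (P : Type) [PartialOrder P] [Nonempty P], CountableChainCondition P →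
    ∀ 𝒟 : Set (Set P), #𝒟 ≤ κ → (∀ D ∈ 𝒟, DenseBelow D) →
      ∃ G : Order.PFilter P, ∀ D ∈ 𝒟, ∃ p ∈ D, p ∈ G

/-! For (a), let `e` be a bijection from `𝒜` to `ℬ`. Martin's axiom supplies sets `S n` with at most
two elements, all at least `n`, such that for each `A ∈ 𝒜` and almost all `n` the set `S n` meets
`A` in exactly one point if `n ∈ e A` and misses `A` otherwise. Put `T f n = f(∞) + ∑ k ∈ S n, (f k
- f(∞))`. For large `n ∈ e A` one summand is close to `f(A) - f(∞)`. The other, if present, lies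
outside the finitely many sets on which `f` is far from `f(∞)`, so it is small. Hence `T f` extends
continuously, with value `f(A)` at `e A` and `f(∞)` at `∞`. With the analogous `T'` for `e⁻¹`, the
two operators are inverse modulo the functions vanishing off `ω`, which form a copy of `c₀`. This
gives `C(K_𝒜) ⊕ c₀ ≃ C(K_ℬ) ⊕ c₀`, and both spaces absorb `c₀`, as they contain it complemented. The
carrying lemmas are `MartinAxiom.exists_link`, `exists_transport_of_link` and `nonempty_absorb`.

For (b), the square is, up to one scalar, the space of the family made of two copies of `𝒜` on
disjoint sets. For infinite `𝒜` that family has the same size, so (a) applies; for finite `𝒜` the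
space is `c₀`.

For (c), `C(K_𝒜)` has only `𝔠` functionals (`mk_dual_le`). An isomorphism from `X` onto `C(K_𝒜)`
pulls the evaluations at the points of `ω` back to a sequence in the dual of `X`. That sequence
determines the restrictions to `ω` of the functions in `C(K_𝒜)`, and these determine `𝒜` among the
infinite subfamilies of a fixed almost disjoint family. So at most `𝔠 ^ ℵ₀ = 𝔠` of the `2 ^ 𝔠`
chosen subfamilies yield the same space up to isomorphism. -/

open Set Filter Topology
open scoped Cardinal ZeroAtInfty

/-! ### The topology of `K_𝒜` and a criterion for continuity -/

namespace KSpace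

variable {𝒜 : Set (Set ℕ)}

/-- A natural number as an isolated point of `K_𝒜`. -/
abbrev ofNat (𝒜 : Set (Set ℕ)) (n : ℕ) : KSpace 𝒜 := ((PsiSpace.nat n : PsiSpace 𝒜) : OnePoint _)

/-- A member of `𝒜` as a point of `K_𝒜`. -/
abbrev ofMem (A : 𝒜) : KSpace 𝒜 := ((PsiSpace.pt A : PsiSpace 𝒜) : OnePoint _)

theorem forall_iff {p : KSpace 𝒜 → Prop} :
    (∀ x, p x) ↔ (∀ n, p (ofNat 𝒜 n)) ∧ (∀ A : 𝒜, p (ofMem A)) ∧ p OnePoint.infty := by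
  refine ⟨fun h => ⟨fun _ => h _, fun _ => h _, h _⟩, fun ⟨h1, h2, h3⟩ x => ?_⟩
  induction x using OnePoint.rec with
  | infty => exact h3
  | coe x => cases x with
    | nat n => exact h1 n
    | pt A => exact h2 A

theorem psi_continuous_iff {f : PsiSpace 𝒜 → ℝ} :
    Continuous f ↔
      ∀ A : 𝒜, ∀ ε > 0, {n ∈ (A : Set ℕ) | ε ≤ |f (.nat n) - f (.pt A)|}.Finite := by
  constructor
  · intro hf A ε hε
    have h := hf.isOpen_preimage _ (Metric.isOpen_ball (x := f (.pt A)) (ε := ε)) A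
      (by simpa using hε)
    refine h.subset ?_
    rintro n ⟨hn, h2⟩
    refine ⟨hn, ?_⟩
    simpa [Real.dist_eq] using h2
  · intro h
    refine continuous_def.2 fun U hU A hA => ?_
    obtain ⟨ε, hε, hb⟩ := Metric.isOpen_iff.1 hU _ hA
    refine (h A ε hε).subset ?_
    rintro n ⟨hn, h2⟩
    refine ⟨hn, ?_⟩
    by_contra h3
    exact h2 (hb (by simpa [Real.dist_eq] using h3))

/-- The clopen set `A ∪ {A}` in `ω ∪ 𝒜`. -/
def cone (A : 𝒜) : Set (PsiSpace 𝒜) := insert (.pt A) (PsiSpace.nat '' (A : Set ℕ))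

theorem pt_mem_cone {A B : 𝒜} : .pt B ∈ cone A ↔ B = A := by
  simp [cone]

theorem nat_mem_cone {A : 𝒜} {n : ℕ} : .nat n ∈ cone A ↔ n ∈ (A : Set ℕ) := by
  simp [cone]

theorem isOpen_singleton_nat (n : ℕ) : IsOpen {(PsiSpace.nat n : PsiSpace 𝒜)} := by
  intro A hA
  simp at hA

theorem isOpen_cone (A : 𝒜) : IsOpen (cone A) := by
  intro B hB
  obtain rfl := pt_mem_cone.1 hB
  convert Set.finite_empty
  ext n
  simp [nat_mem_cone]

theorem isCompact_cone (A : 𝒜) : IsCompact (cone A) := by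
  rw [isCompact_iff_finite_subcover]
  intro ι U hU hc
  obtain ⟨i, hi⟩ := mem_iUnion.1 (hc (mem_insert _ _))
  have hfin := hU i A hi
  have h2 : ∀ n ∈ (A : Set ℕ), ∃ j, (PsiSpace.nat n : PsiSpace 𝒜) ∈ U j := fun n hn =>
    mem_iUnion.1 (hc (mem_insert_of_mem _ (mem_image_of_mem _ hn)))
  have : Nonempty ι := ⟨i⟩
  choose! j hj using h2
  classical
  refine ⟨insert i (hfin.toFinset.image j), ?_⟩
  rintro x (rfl | ⟨n, hn, rfl⟩)
  · exact mem_biUnion (Finset.mem_insert_self _ _) hi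
  · by_cases h : (PsiSpace.nat n : PsiSpace 𝒜) ∈ U i
    · exact mem_biUnion (Finset.mem_insert_self _ _) h
    · refine mem_biUnion (Finset.mem_insert_of_mem (Finset.mem_image_of_mem j ?_)) (hj n hn)
      simpa using ⟨hn, h⟩

/-- Almost disjointness enters here: a member `B` outside `F` meets each of the finitely many
members of `F` in a finite set, so a neighbourhood of `B` avoids the union. -/
theorem isClosed_cone_union (h𝒜 : AlmostDisjoint 𝒜) (F : Finset 𝒜) {E : Set ℕ} (hE : E.Finite) :
    IsClosed ((⋃ A ∈ F, cone A) ∪ PsiSpace.nat '' E) := by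
  rw [← isOpen_compl_iff]
  intro B hB
  have hBF : B ∉ F := fun h => hB (Or.inl (mem_biUnion h (mem_insert _ _)))
  refine ((F.finite_toSet.biUnion (t := fun A => (A : Set ℕ) ∩ B) fun A hA => ?_).union
    hE).subset ?_
  · exact h𝒜.2 A.2 B.2 fun h => hBF (Subtype.ext h ▸ hA)
  · rintro n ⟨hn, h⟩
    simp only [mem_compl_iff, not_not] at h
    rcases h with h | ⟨m, hm, h⟩
    · simp only [mem_iUnion] at h
      obtain ⟨A, hA, h⟩ := h
      refine Or.inl (mem_biUnion hA ⟨?_, hn⟩)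
      exact nat_mem_cone.1 h
    · cases h
      exact Or.inr hm

theorem isCompact_subset_cone {K : Set (PsiSpace 𝒜)} (hK : IsCompact K) :
    ∃ (F : Finset 𝒜) (E : Set ℕ), E.Finite ∧ K ⊆ (⋃ A ∈ F, cone A) ∪ PsiSpace.nat '' E := by
  classical
  obtain ⟨t, ht⟩ := hK.elim_finite_subcover
    (fun i : 𝒜 ⊕ ℕ => Sum.elim cone (fun n => {PsiSpace.nat n}) i)
    (by rintro (A | n); exacts [isOpen_cone A, isOpen_singleton_nat n])
    (by
      rintro (n | A) -
      · exact mem_iUnion.2 ⟨Sum.inr n, rfl⟩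
      · exact mem_iUnion.2 ⟨Sum.inl A, mem_insert _ _⟩)
  refine ⟨t.toLeft, t.toRight, t.toRight.finite_toSet, fun x hx => ?_⟩
  obtain ⟨i, hi, h⟩ := mem_iUnion₂.1 (ht hx)
  rcases i with A | n
  · exact Or.inl (mem_biUnion (by simpa using hi) h)
  · exact Or.inr ⟨n, by simpa using hi, h.symm⟩

/-- Finite unions of cones together with finite subsets of `ω` are cofinal among the closed compact
subsets of `ω ∪ 𝒜`, so convergence at `∞` need only be tested on their complements. The criterion
reduces all later continuity proofs to finiteness of sets of integers. -/
theorem continuous_iff (h𝒜 : AlmostDisjoint 𝒜) {f : KSpace 𝒜 → ℝ} :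
    Continuous f ↔
      (∀ A : 𝒜, ∀ ε > 0, {n ∈ (A : Set ℕ) | ε ≤ |f (ofNat 𝒜 n) - f (ofMem A)|}.Finite) ∧
      ∀ ε > 0, ∃ F : Finset 𝒜, (∀ A ∉ F, |f (ofMem A) - f OnePoint.infty| < ε) ∧
        {n | (∀ A ∈ F, n ∉ (A : Set ℕ)) ∧ ε ≤ |f (ofNat 𝒜 n) - f OnePoint.infty|}.Finite := by
  rw [OnePoint.continuous_iff, psi_continuous_iff, and_comm]
  refine and_congr_right fun _ => ?_
  rw [Metric.tendsto_nhds]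
  refine forall₂_congr fun ε hε => ?_
  rw [Filter.Eventually, hasBasis_coclosedCompact.mem_iff]
  constructor
  · rintro ⟨K, ⟨-, hK⟩, h⟩
    obtain ⟨F, E, hE, hKF⟩ := isCompact_subset_cone hK
    refine ⟨F, fun A hA => ?_, hE.subset ?_⟩
    · have : (PsiSpace.pt A : PsiSpace 𝒜) ∉ K := by
        intro hAK
        rcases hKF hAK with h | ⟨n, -, h⟩
        · obtain ⟨B, hB, h⟩ := mem_iUnion₂.1 h
          exact hA (pt_mem_cone.1 h ▸ hB)
        · cases h
      simpa [Real.dist_eq] using h this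
    · rintro n ⟨hn, h2⟩
      by_contra hnE
      have : (PsiSpace.nat n : PsiSpace 𝒜) ∉ K := by
        intro hAK
        rcases hKF hAK with h | ⟨m, hm, h⟩
        · obtain ⟨B, hB, h⟩ := mem_iUnion₂.1 h
          exact hn B hB (nat_mem_cone.1 h)
        · cases h
          exact hnE hm
      have := h this
      simp only [mem_ofPred_eq, Real.dist_eq] at this
      exact absurd h2 (not_le.2 this)
  · rintro ⟨F, hF, hE⟩
    refine ⟨_, ⟨isClosed_cone_union h𝒜 F hE, (F.isCompact_biUnion fun A _ =>
      isCompact_cone A).union (hE.image _).isCompact⟩, ?_⟩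
    rintro (n | A) hx
    · simp only [mem_compl_iff, mem_union, not_or, mem_iUnion, not_exists] at hx
      simp only [mem_ofPred_eq, Real.dist_eq]
      by_contra h
      refine hx.2 ⟨n, ⟨fun A hA hn => hx.1 A hA (mem_insert_of_mem _ ⟨n, hn, rfl⟩), not_lt.1 h⟩, rfl⟩
    · simp only [mem_ofPred_eq, Real.dist_eq]
      exact hF A fun hA => hx (Or.inl (mem_biUnion hA (mem_insert _ _)))

theorem finite_of_mem (h𝒜 : AlmostDisjoint 𝒜) (f : C(KSpace 𝒜, ℝ)) (A : 𝒜) {ε : ℝ} (hε : 0 < ε) :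
    {n ∈ (A : Set ℕ) | ε ≤ |f (ofNat 𝒜 n) - f (ofMem A)|}.Finite :=
  ((continuous_iff h𝒜).1 f.continuous).1 A ε hε

theorem exists_finset (h𝒜 : AlmostDisjoint 𝒜) (f : C(KSpace 𝒜, ℝ)) {ε : ℝ} (hε : 0 < ε) :
    ∃ F : Finset 𝒜, (∀ A ∉ F, |f (ofMem A) - f OnePoint.infty| < ε) ∧
      {n | (∀ A ∈ F, n ∉ (A : Set ℕ)) ∧ ε ≤ |f (ofNat 𝒜 n) - f OnePoint.infty|}.Finite :=
  ((continuous_iff h𝒜).1 f.continuous).2 ε hε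

theorem abs_apply_le (f : C(KSpace 𝒜, ℝ)) (x : KSpace 𝒜) : |f x| ≤ ‖f‖ := f.norm_coe_le_norm x

/-- The function on `K_𝒜` with the given values on `ω`, on `𝒜` and at `∞`. -/
def glue (u : ℕ → ℝ) (v : 𝒜 → ℝ) (w : ℝ) : KSpace 𝒜 → ℝ
  | none => w
  | some (.nat n) => u n
  | some (.pt A) => v A

theorem ext_iff' {f g : C(KSpace 𝒜, ℝ)} :
    f = g ↔ (∀ n, f (ofNat 𝒜 n) = g (ofNat 𝒜 n)) ∧ (∀ A : 𝒜, f (ofMem A) = g (ofMem A)) ∧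
      f OnePoint.infty = g OnePoint.infty := by
  rw [ContinuousMap.ext_iff, forall_iff]

theorem norm_le_iff {f : C(KSpace 𝒜, ℝ)} {C : ℝ} :
    ‖f‖ ≤ C ↔ (∀ n, |f (ofNat 𝒜 n)| ≤ C) ∧ (∀ A : 𝒜, |f (ofMem A)| ≤ C) ∧
      |f OnePoint.infty| ≤ C := by
  rw [ContinuousMap.norm_le_of_nonempty, forall_iff]
  rfl

end KSpace

/-! ### Martin's axiom and the linking sequence -/

/-- Martin's axiom for `κ` also handles countably many dense sets, whether or not `κ` is finite. -/
theorem MartinAxiom.max_aleph0 {κ : Cardinal.{0}} (h : MartinAxiom κ) : MartinAxiom (max κ ℵ₀) := by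
  rcases le_total ℵ₀ κ with hκ | hκ
  · rwa [max_eq_left hκ]
  rw [max_eq_right hκ]
  intro P _ hP _ 𝒟 h𝒟 hd
  have : Countable 𝒟 := Cardinal.mk_le_aleph0_iff.1 h𝒟
  have := Encodable.ofCountable 𝒟
  -- For countably many dense sets this is the Rasiowa–Sikorski lemma; filters of `P` are ideals of
  -- the dual order.
  let D : 𝒟 → Order.Cofinal Pᵒᵈ := fun D =>
    ⟨OrderDual.ofDual ⁻¹' (D : Set P), fun p => by
      obtain ⟨d, h1, h2⟩ := hd D D.2 (OrderDual.ofDual p)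
      exact ⟨OrderDual.toDual d, h1, h2⟩⟩
  refine ⟨⟨Order.idealOfCofinals (OrderDual.toDual hP.some) D⟩, fun E hE => ?_⟩
  obtain ⟨x, h1, h2⟩ := Order.cofinal_meets_idealOfCofinals (OrderDual.toDual hP.some) D ⟨E, hE⟩
  exact ⟨OrderDual.ofDual x, h1, h2⟩

namespace Linking

variable {ι : Type} (A B : ι → Set ℕ)

/-- The finite set `t` meets `A α` in exactly one point if `n ∈ B α` and in none otherwise. -/
def Good (n : ℕ) (t : Finset ℕ) (α : ι) : Prop :=
  (n ∈ B α → ∃! k, k ∈ t ∧ k ∈ A α) ∧ (n ∉ B α → ∀ k ∈ t, k ∉ A α)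

/-- The members of `F` are disjoint from `N` on. -/
def DisjAbove (N : ℕ) (F : Finset ι) : Prop :=
  ∀ α ∈ F, ∀ β ∈ F, α ≠ β → ∀ n ≥ N, n ∈ B α → n ∉ B β

variable {A B} in
-- From `N` on, `n` lies in `B α` for at most one `α` in each of `F₁` and `F₂`. So at most two
-- points are needed, each chosen in its `A α` outside all other relevant `A β`. This is the origin
-- of the bound two.
theorem exists_term (hA : ∀ α, (A α).Infinite) (hAd : ∀ α β, α ≠ β → (A α ∩ A β).Finite)
    [DecidableEq ι] {N n : ℕ} {F₁ F₂ : Finset ι} (h₁ : DisjAbove B N F₁) (h₂ : DisjAbove B N F₂)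
    (hn : N ≤ n) :
    ∃ t : Finset ℕ, t.card ≤ 2 ∧ (∀ k ∈ t, n ≤ k) ∧ ∀ α ∈ F₁ ∪ F₂, Good A B n t α := by
  classical
  have key : ∀ α, ∃ a, n ≤ a ∧ a ∈ A α ∧ ∀ β ∈ F₁ ∪ F₂, β ≠ α → a ∉ A β := by
    intro α
    have hfin : ((⋃ β ∈ ((F₁ ∪ F₂).erase α : Finset ι), A α ∩ A β) ∪ Iio n).Finite :=
      ((Finset.finite_toSet _).biUnion fun β hβ =>
        hAd _ _ (Finset.ne_of_mem_erase hβ).symm).union (finite_Iio n)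
    obtain ⟨a, ha, ha'⟩ := ((hA α).sdiff hfin).nonempty
    simp only [mem_union, mem_iUnion, not_or, not_exists, mem_Iio, not_lt] at ha'
    exact ⟨a, ha'.2, ha, fun β hβ hne h => ha'.1 β (Finset.mem_erase.2 ⟨hne, hβ⟩) ⟨ha, h⟩⟩
  choose a ha1 ha2 ha3 using key
  have hcard : ∀ F : Finset ι, DisjAbove B N F → ((F.filter (n ∈ B ·)).image a).card ≤ 1 := by
    intro F hF
    refine Finset.card_image_le.trans (Finset.card_le_one.2 fun x hx y hy => ?_)
    rw [Finset.mem_filter] at hx hy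
    by_contra hne
    exact hF x hx.1 y hy.1 hne n hn hx.2 hy.2
  refine ⟨((F₁ ∪ F₂).filter (n ∈ B ·)).image a, ?_, ?_, fun α hα => ⟨fun h => ?_, fun h k hk => ?_⟩⟩
  · rw [Finset.filter_union, Finset.image_union]
    exact (Finset.card_union_le _ _).trans (add_le_add (hcard _ h₁) (hcard _ h₂))
  · intro k hk
    obtain ⟨α, -, rfl⟩ := Finset.mem_image.1 hk
    exact ha1 α
  · refine ⟨a α, ⟨Finset.mem_image_of_mem a (Finset.mem_filter.2 ⟨hα, h⟩), ha2 α⟩, ?_⟩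
    rintro k ⟨hk, hkA⟩
    obtain ⟨β, hβ, rfl⟩ := Finset.mem_image.1 hk
    by_contra hne
    exact ha3 β α hα (fun h => hne (by rw [h])) hkA
  · obtain ⟨β, hβ, rfl⟩ := Finset.mem_image.1 hk
    exact ha3 β α hα fun hab => h (hab ▸ (Finset.mem_filter.1 hβ).2)

variable {B} in
theorem exists_disjAbove (hBd : ∀ α β, α ≠ β → (B α ∩ B β).Finite) (F : Finset ι) :
    ∃ N, DisjAbove B N F := by
  have hfin : (⋃ α ∈ F, ⋃ β ∈ F, ⋃ _ : α ≠ β, B α ∩ B β).Finite :=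
    F.finite_toSet.biUnion fun α _ => F.finite_toSet.biUnion fun β _ =>
      finite_iUnion fun h => hBd α β h
  obtain ⟨N, hN⟩ := hfin.bddAbove
  refine ⟨N + 1, fun α hα β hβ hne n hn h1 h2 => ?_⟩
  have : n ≤ N := hN (by simp only [mem_iUnion]; exact ⟨α, hα, β, hβ, hne, h1, h2⟩)
  omega

theorem DisjAbove.mono {B : ι → Set ℕ} {N M : ℕ} {F : Finset ι} (h : DisjAbove B N F)
    (hNM : N ≤ M) : DisjAbove B M F :=
  fun α hα β hβ hne n hn => h α hα β hβ hne n (hNM.trans hn)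

/-- Finite approximations to a sequence of finite sets linking `B` to `A`: the sequence is known
below `len`, and the members of `side` restrict all later terms. -/
@[ext] structure Approx (A B : ι → Set ℕ) where
  len : ℕ
  stem : ℕ → Finset ℕ
  side : Finset ι
  card_le : ∀ n, (stem n).card ≤ 2
  le_of_mem : ∀ n, ∀ k ∈ stem n, n ≤ k
  stem_eq : ∀ n ≥ len, stem n = ∅
  disj : DisjAbove B len side

variable {A B}

instance : PartialOrder (Approx A B) where
  le q p := p.len ≤ q.len ∧ (∀ n < p.len, q.stem n = p.stem n) ∧ p.side ⊆ q.side ∧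
    ∀ n, p.len ≤ n → n < q.len → ∀ α ∈ p.side, Good A B n (q.stem n) α
  le_refl p := ⟨le_rfl, fun _ _ => rfl, subset_rfl, fun n h1 h2 => by omega⟩
  le_trans r q p := by
    rintro ⟨h1, h2, h3, h4⟩ ⟨g1, g2, g3, g4⟩
    refine ⟨g1.trans h1, fun n hn => (h2 n (by omega)).trans (g2 n hn), g3.trans h3,
      fun n hn hn' α hα => ?_⟩
    by_cases h : n < q.len
    · rw [h2 n h]
      exact g4 n hn h α hα
    · exact h4 n (by omega) hn' α (g3 hα)
  le_antisymm p q := by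
    rintro ⟨h1, h2, h3, -⟩ ⟨g1, g2, g3, -⟩
    have hl : p.len = q.len := le_antisymm g1 h1
    refine Approx.ext hl (funext fun n => ?_) (subset_antisymm g3 h3)
    by_cases h : n < q.len
    · exact h2 n h
    · rw [p.stem_eq n (by omega), q.stem_eq n (by omega)]

instance : Nonempty (Approx A B) :=
  ⟨⟨0, fun _ => ∅, ∅, by simp, by simp, by simp, by simp [DisjAbove]⟩⟩

/-- The sets `p.side` and `F` are each disjoint from `p.len` on, but their union need not be.
Filling in terms by `exists_term` up to a length past which the union is disjoint makes the union an
admissible side. Both density and the chain condition follow from this. -/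
theorem Approx.exists_le (hA : ∀ α, (A α).Infinite) (hAd : ∀ α β, α ≠ β → (A α ∩ A β).Finite)
    (hBd : ∀ α β, α ≠ β → (B α ∩ B β).Finite) (p : Approx A B) {F : Finset ι}
    (hF : DisjAbove B p.len F) (M : ℕ) :
    ∃ r ≤ p, M ≤ r.len ∧ F ⊆ r.side ∧
      ∀ n, p.len ≤ n → n < r.len → ∀ α ∈ F, Good A B n (r.stem n) α := by
  classical
  obtain ⟨N, hN⟩ := exists_disjAbove hBd (p.side ∪ F)
  have key : ∀ n, ∃ t : Finset ℕ, t.card ≤ 2 ∧ (∀ k ∈ t, n ≤ k) ∧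
      (p.len ≤ n → ∀ α ∈ p.side ∪ F, Good A B n t α) := by
    intro n
    by_cases hn : p.len ≤ n
    · obtain ⟨t, h1, h2, h3⟩ := exists_term hA hAd p.disj hF hn
      exact ⟨t, h1, h2, fun _ => h3⟩
    · exact ⟨∅, by simp, by simp, fun h => absurd h hn⟩
  choose t ht1 ht2 ht3 using key
  let L := max (max N M) p.len
  let s : ℕ → Finset ℕ := fun n => if n < p.len then p.stem n else if n < L then t n else ∅
  have hs : ∀ n, p.len ≤ n → n < L → s n = t n := fun n h1 h2 => by
    simp only [s, if_neg (not_lt.2 h1), if_pos h2]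
  refine ⟨⟨L, s, p.side ∪ F, fun n => ?_, fun n => ?_, fun n hn => ?_, hN.mono ?_⟩,
    ⟨le_max_right _ _, fun n hn => if_pos hn, Finset.subset_union_left, fun n h1 h2 α hα => ?_⟩,
    (le_max_right _ _).trans (le_max_left _ _), Finset.subset_union_right,
    fun n h1 h2 α hα => ?_⟩
  · simp only [s]
    split_ifs
    exacts [p.card_le n, ht1 n, by simp]
  · simp only [s]
    split_ifs
    exacts [p.le_of_mem n, ht2 n, by simp]
  · have : p.len ≤ L := le_max_right _ _
    simp only [s]
    rw [if_neg (by omega), if_neg (by omega)]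
  · exact (le_max_left _ _).trans (le_max_left _ _)
  · show Good A B n (s n) α
    rw [hs n h1 h2]
    exact ht3 n h1 α (Finset.mem_union_left _ hα)
  · show Good A B n (s n) α
    rw [hs n h1 h2]
    exact ht3 n h1 α (Finset.mem_union_right _ hα)

/-- Conditions with the same stem are compatible, whatever their sides, and there are only countably
many stems. -/
theorem Approx.ccc (hA : ∀ α, (A α).Infinite) (hAd : ∀ α β, α ≠ β → (A α ∩ A β).Finite)
    (hBd : ∀ α β, α ≠ β → (B α ∩ B β).Finite) : CountableChainCondition (Approx A B) := by
  intro S hS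
  let c : Approx A B → List (Finset ℕ) := fun p => (List.range p.len).map p.stem
  have hc : ∀ p q, c p = c q → ∃ r, r ≤ p ∧ r ≤ q := by
    intro p q h
    have hl : p.len = q.len := by simpa [c] using congrArg List.length h
    have hst : ∀ n < p.len, p.stem n = q.stem n := by
      simp only [c, ← hl] at h
      intro n hn
      exact List.map_inj_left.1 h n (List.mem_range.2 hn)
    obtain ⟨r, hr, -, h1, h2⟩ := p.exists_le hA hAd hBd (hl ▸ q.disj) 0
    refine ⟨r, hr, hl ▸ hr.1, fun n hn => ?_, h1, hl ▸ h2⟩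
    rw [hr.2.1 n (hl ▸ hn), hst n (hl ▸ hn)]
  refine Set.MapsTo.countable_of_injOn (mapsTo_univ c S) (fun p hp q hq h => ?_) countable_univ
  by_contra hne
  exact hS hp hq hne (hc p q h)

end Linking

open Linking in
/-- Under Martin's axiom any two almost disjoint families of the same size `κ` are linked by a
sequence of sets with at most two elements. -/
theorem MartinAxiom.exists_link {κ : Cardinal.{0}} (hMA : MartinAxiom κ) {ι : Type} (hι : #ι ≤ κ)
    {A B : ι → Set ℕ} (hA : ∀ α, (A α).Infinite) (hAd : ∀ α β, α ≠ β → (A α ∩ A β).Finite)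
    (hBd : ∀ α β, α ≠ β → (B α ∩ B β).Finite) :
    ∃ S : ℕ → Finset ℕ, (∀ n, (S n).card ≤ 2) ∧ (∀ n, ∀ k ∈ S n, n ≤ k) ∧
      ∀ α, ∃ N, ∀ n ≥ N, Good A B n (S n) α := by
  let D : ι ⊕ ℕ → Set (Approx A B) := Sum.elim (fun α => {p | α ∈ p.side}) fun N => {p | N ≤ p.len}
  obtain ⟨G, hG⟩ := hMA.max_aleph0 (Approx A B) (Approx.ccc hA hAd hBd) (range D)
    (by
      refine Cardinal.mk_range_le.trans ?_
      rw [Cardinal.mk_sum, Cardinal.lift_id, Cardinal.lift_id, Cardinal.mk_nat]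
      exact Cardinal.add_le_of_le (le_max_right _ _) (hι.trans (le_max_left _ _))
        (le_max_right _ _))
    (by
      rintro _ ⟨α | N, rfl⟩ p
      · obtain ⟨r, h1, -, h2, -⟩ := p.exists_le hA hAd hBd (F := {α})
          (fun x hx y hy hne => by simp_all) 0
        exact ⟨r, h2 (by simp), h1⟩
      · obtain ⟨r, h1, h2, -⟩ := p.exists_le hA hAd hBd (F := ∅) (by simp [DisjAbove]) N
        exact ⟨r, h2, h1⟩)
  have hlen : ∀ N, ∃ p ∈ G, N ≤ p.len := fun N => by
    obtain ⟨p, h1, h2⟩ := hG _ ⟨Sum.inr N, rfl⟩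
    exact ⟨p, h2, h1⟩
  -- The `n`-th term is decided only by a condition of length greater than `n`.
  choose p hpG hp using fun n => hlen (n + 1)
  refine ⟨fun n => (p n).stem n, fun n => (p n).card_le n, fun n => (p n).le_of_mem n,
    fun α => ?_⟩
  obtain ⟨q, h1, h2⟩ := hG _ ⟨Sum.inl α, rfl⟩
  refine ⟨q.len, fun n hn => ?_⟩
  -- A common extension `r` has the same `n`-th term as `p n` and is bound at `n` by the promise of
  -- `q` concerning `α`.
  obtain ⟨r, -, hr1, hr2⟩ := G.directed _ h2 _ (hpG n)
  have hpn := hp n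
  change Good A B n ((p n).stem n) α
  rw [← hr2.2.1 n (by omega)]
  exact hr1.2.2.2 n hn (by have := hr2.1; omega) α h1

/-! ### The space `c₀` over discrete sets -/

namespace ZeroAtInftyContinuousMap

theorem abs_apply_le {α : Type} [TopologicalSpace α] (f : C₀(α, ℝ)) (i : α) : |f i| ≤ ‖f‖ :=
  f.toBCF.norm_coe_le_norm i

theorem norm_le_of_forall {α : Type} [TopologicalSpace α] {f : C₀(α, ℝ)} {C : ℝ} (hC : 0 ≤ C)
    (h : ∀ i, |f i| ≤ C) : ‖f‖ ≤ C :=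
  (BoundedContinuousFunction.norm_le (f := f.toBCF) hC).2 h

variable {α β γ : Type} [TopologicalSpace α] [DiscreteTopology α] [TopologicalSpace β]
  [DiscreteTopology β] [TopologicalSpace γ] [DiscreteTopology γ]

theorem finite_le_abs (f : C₀(α, ℝ)) {ε : ℝ} (hε : 0 < ε) : {i | ε ≤ |f i|}.Finite := by
  have h := zero_at_infty f
  rw [cocompact_eq_cofinite, Metric.tendsto_nhds] at h
  simpa [eventually_cofinite] using h ε hε

/-- A function on a discrete space that tends to zero along the cofinite filter. -/
def ofFinite (u : α → ℝ) (hu : ∀ ε > 0, {i | ε ≤ |u i|}.Finite) : C₀(α, ℝ) where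
  toFun := u
  continuous_toFun := continuous_of_discreteTopology
  zero_at_infty' := by
    rw [cocompact_eq_cofinite, Metric.tendsto_nhds]
    simpa [eventually_cofinite] using hu

@[simp] theorem ofFinite_apply (u : α → ℝ) (hu : ∀ ε > 0, {i | ε ≤ |u i|}.Finite) (i : α) :
    ofFinite u hu i = u i := rfl

/-- Composition with an injection of discrete spaces. -/
noncomputable def compInj (j : α → β) (hj : j.Injective) : C₀(β, ℝ) →L[ℝ] C₀(α, ℝ) :=
  LinearMap.mkContinuous
    { toFun := fun f => ofFinite (fun i => f (j i)) fun ε hε =>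
        Finite.preimage (s := {i | ε ≤ |f i|}) (f := j) hj.injOn (f.finite_le_abs hε)
      map_add' := fun _ _ => rfl
      map_smul' := fun _ _ => rfl } 1
    fun f => norm_le_of_forall (by positivity) fun i => (f.abs_apply_le (j i)).trans_eq (one_mul _).symm

@[simp] theorem compInj_apply (j : α → β) (hj : j.Injective) (f : C₀(β, ℝ)) (i : α) :
    compInj j hj f i = f (j i) := rfl

/-- The splitting of `C₀(γ, ℝ)` induced by a splitting of the discrete space `γ`. -/
noncomputable def sumEquiv (e : γ ≃ α ⊕ β) : C₀(γ, ℝ) ≃L[ℝ] C₀(α, ℝ) × C₀(β, ℝ) :=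
  LinearEquiv.toContinuousLinearEquivOfContinuous
    { ((compInj (e.symm ∘ Sum.inl) (e.symm.injective.comp Sum.inl_injective)).prod
        (compInj (e.symm ∘ Sum.inr) (e.symm.injective.comp Sum.inr_injective)) :
        C₀(γ, ℝ) →L[ℝ] C₀(α, ℝ) × C₀(β, ℝ)).toLinearMap with
      invFun := fun p => ofFinite (fun i => Sum.elim p.1 p.2 (e i)) fun ε hε => by
        refine ((((p.1.finite_le_abs hε).image Sum.inl).union
          ((p.2.finite_le_abs hε).image Sum.inr)).preimage e.injective.injOn).subset fun i hi => ?_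
        simp only [mem_ofPred_eq] at hi
        rcases h : e i with a | b
        · exact Or.inl ⟨a, by simpa [h] using hi, h.symm⟩
        · exact Or.inr ⟨b, by simpa [h] using hi, h.symm⟩
      left_inv := fun f => by
        ext i
        change Sum.elim (fun a => f (e.symm (Sum.inl a))) (fun b => f (e.symm (Sum.inr b))) (e i) = _
        rcases h : e i with a | b
        · exact congrArg f (e.symm_apply_eq.2 h.symm)
        · exact congrArg f (e.symm_apply_eq.2 h.symm)
      right_inv := fun p => by
        ext i <;> simp }
    (ContinuousLinearMap.continuous _)

/-- On a finite discrete space every function vanishes at infinity. -/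
noncomputable def finiteEquiv (α : Type) [TopologicalSpace α] [DiscreteTopology α] [Finite α] :
    C₀(α, ℝ) ≃L[ℝ] (α → ℝ) :=
  (LinearEquiv.toContinuousLinearEquiv
    ({ toFun := fun u => ofFinite u fun _ _ => toFinite _
       map_add' := fun _ _ => rfl
       map_smul' := fun _ _ => rfl
       invFun := fun f => f
       left_inv := fun _ => rfl
       right_inv := fun _ => rfl } : (α → ℝ) ≃ₗ[ℝ] C₀(α, ℝ))).symm

/-- The space `c₀` is isomorphic to its square. -/
noncomputable def natProdEquiv : C₀(ℕ, ℝ) ≃L[ℝ] C₀(ℕ, ℝ) × C₀(ℕ, ℝ) :=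
  sumEquiv Equiv.natSumNatEquivNat.symm

/-- The space `c₀` is isomorphic to its product with any finite power of the scalars. -/
noncomputable def natProdFinite (α : Type) [Finite α] : C₀(ℕ, ℝ) ≃L[ℝ] C₀(ℕ, ℝ) × (α → ℝ) :=
  letI : TopologicalSpace α := ⊥
  haveI : DiscreteTopology α := ⟨rfl⟩
  (sumEquiv (Classical.choice (by
    have : #ℕ = #(ℕ ⊕ α) := by
      simp
    exact Cardinal.eq.1 this))).trans ((ContinuousLinearEquiv.refl ℝ _).prodCongr (finiteEquiv α))

end ZeroAtInftyContinuousMap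

/-! ### Decomposition arguments for Banach spaces -/

/-- A Banach space with a complemented copy of `c₀` absorbs one more copy of `c₀`. -/
theorem nonempty_equiv_prod_of_rightInverse {X : Type} [NormedAddCommGroup X] [NormedSpace ℝ X]
    (R : X →L[ℝ] C₀(ℕ, ℝ)) (J : C₀(ℕ, ℝ) →L[ℝ] X) (h : Function.RightInverse J R) :
    Nonempty (X ≃L[ℝ] C₀(ℕ, ℝ) × X) := by
  -- This is `X ≃ c₀ × ker R`; splitting `c₀` as `c₀ × c₀` then frees one copy.
  let e := ContinuousLinearEquiv.equivOfRightInverse R J h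
  exact ⟨(e.trans (ZeroAtInftyContinuousMap.natProdEquiv.prodCongr
    (ContinuousLinearEquiv.refl ℝ _))).trans
    ((ContinuousLinearEquiv.prodAssoc ℝ _ _ _).trans
      ((ContinuousLinearEquiv.refl ℝ _).prodCongr e.symm))⟩

/-- If `T` and `T'` are inverse to each other modulo the subspaces `M` and `N`, then `X × N` and
`Y × M` are isomorphic. -/
def ContinuousLinearMap.equivProdOfInverseMod {X Y : Type} [NormedAddCommGroup X]
    [NormedSpace ℝ X] [NormedAddCommGroup Y] [NormedSpace ℝ Y] {M : Submodule ℝ X}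
    {N : Submodule ℝ Y} (T : X →L[ℝ] Y) (T' : Y →L[ℝ] X) (hT : ∀ x ∈ M, T x ∈ N)
    (hT' : ∀ y ∈ N, T' y ∈ M) (hTT : ∀ x, x - T' (T x) ∈ M) (hTT' : ∀ y, y - T (T' y) ∈ N) :
    (X × N) ≃L[ℝ] Y × M where
  -- The second coordinate is the error of recovering `x` from `y = T x + n` by `T'`. Adding it to
  -- `T' y` returns `x`, and then `y - T x = n`.
  toFun p := (T p.1 + p.2, ⟨p.1 - T' (T p.1 + p.2), by
    rw [map_add, ← sub_sub]
    exact M.sub_mem (hTT _) (hT' _ p.2.2)⟩)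
  invFun p := (T' p.1 + p.2, ⟨p.1 - T (T' p.1 + p.2), by
    rw [map_add, ← sub_sub]
    exact N.sub_mem (hTT' _) (hT _ p.2.2)⟩)
  map_add' p q := by
    ext
    · simp only [Prod.fst_add, Prod.snd_add, map_add, Submodule.coe_add]; abel
    · simp only [Prod.fst_add, Prod.snd_add, map_add, Submodule.coe_add]; abel
  map_smul' c p := by
    ext
    · simp
    · simp [smul_sub]
  left_inv p := by ext <;> simp
  right_inv p := by ext <;> simp
  continuous_toFun := by fun_prop
  continuous_invFun := by fun_prop

theorem Nat.finite_setOf_of_eventually {p : ℕ → Prop} (h : ∀ᶠ n in atTop, ¬ p n) :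
    {n | p n}.Finite := by
  rw [← Nat.cofinite_eq_atTop, eventually_cofinite] at h
  simpa using h

theorem Set.Finite.eventually_atTop_notMem {s : Set ℕ} (h : s.Finite) : ∀ᶠ n in atTop, n ∉ s := by
  rw [← Nat.cofinite_eq_atTop]
  exact h.eventually_cofinite_notMem

/-! ### The copy of `c₀` in `C(K_𝒜)` and its absorption -/

namespace KSpace

variable {𝒜 ℬ : Set (Set ℕ)}

/-- The continuous function on `K_𝒜` with given values, when these satisfy the criterion for
continuity. -/
def mk (h𝒜 : AlmostDisjoint 𝒜) (u : ℕ → ℝ) (v : 𝒜 → ℝ) (w : ℝ)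
    (h₁ : ∀ A : 𝒜, ∀ ε > 0, {n ∈ (A : Set ℕ) | ε ≤ |u n - v A|}.Finite)
    (h₂ : ∀ ε > 0, ∃ F : Finset 𝒜, (∀ A ∉ F, |v A - w| < ε) ∧
      {n | (∀ A ∈ F, n ∉ (A : Set ℕ)) ∧ ε ≤ |u n - w|}.Finite) : C(KSpace 𝒜, ℝ) :=
  ⟨glue u v w, (continuous_iff h𝒜).2 ⟨h₁, h₂⟩⟩

section mk

variable (h𝒜 : AlmostDisjoint 𝒜) (u : ℕ → ℝ) (v : 𝒜 → ℝ) (w : ℝ)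
    (h₁ : ∀ A : 𝒜, ∀ ε > 0, {n ∈ (A : Set ℕ) | ε ≤ |u n - v A|}.Finite)
    (h₂ : ∀ ε > 0, ∃ F : Finset 𝒜, (∀ A ∉ F, |v A - w| < ε) ∧
      {n | (∀ A ∈ F, n ∉ (A : Set ℕ)) ∧ ε ≤ |u n - w|}.Finite)

@[simp] theorem mk_nat (n : ℕ) : mk h𝒜 u v w h₁ h₂ (ofNat 𝒜 n) = u n := rfl
@[simp] theorem mk_mem (A : 𝒜) : mk h𝒜 u v w h₁ h₂ (ofMem A) = v A := rfl
@[simp] theorem mk_infty : mk h𝒜 u v w h₁ h₂ OnePoint.infty = w := rfl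

end mk

variable (𝒜) in
/-- The functions that vanish off `ω`. -/
def nullSubspace : Submodule ℝ C(KSpace 𝒜, ℝ) where
  carrier := {f | (∀ A : 𝒜, f (ofMem A) = 0) ∧ f OnePoint.infty = 0}
  add_mem' := fun ⟨h1, h2⟩ ⟨g1, g2⟩ => ⟨fun A => by simp [h1, g1], by simp [h2, g2]⟩
  zero_mem' := ⟨fun _ => rfl, rfl⟩
  smul_mem' := fun c f ⟨h1, h2⟩ => ⟨fun A => by simp [h1], by simp [h2]⟩

theorem mem_nullSubspace {f : C(KSpace 𝒜, ℝ)} :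
    f ∈ nullSubspace 𝒜 ↔ (∀ A : 𝒜, f (ofMem A) = 0) ∧ f OnePoint.infty = 0 := Iff.rfl

/-- Extension by zero of null sequences. -/
noncomputable def extendNull (h𝒜 : AlmostDisjoint 𝒜) : C₀(ℕ, ℝ) →L[ℝ] C(KSpace 𝒜, ℝ) :=
  LinearMap.mkContinuous
    { toFun := fun h => mk h𝒜 h 0 0
        (fun A ε hε => (h.finite_le_abs hε).subset fun n hn => by simpa using hn.2)
        (fun ε hε => ⟨∅, fun _ _ => by simpa using hε, by simpa using h.finite_le_abs hε⟩)
      map_add' := fun f g => by rw [ext_iff']; simp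
      map_smul' := fun c f => by rw [ext_iff']; simp } 1
    fun f => by
      rw [norm_le_iff]
      simpa using f.abs_apply_le

section extendNull

variable (h𝒜 : AlmostDisjoint 𝒜) (h : C₀(ℕ, ℝ))

@[simp] theorem extendNull_nat (n : ℕ) : extendNull h𝒜 h (ofNat 𝒜 n) = h n := rfl
@[simp] theorem extendNull_mem (A : 𝒜) : extendNull h𝒜 h (ofMem A) = 0 := rfl
@[simp] theorem extendNull_infty : extendNull h𝒜 h OnePoint.infty = 0 := rfl

end extendNull

theorem finite_of_null (h𝒜 : AlmostDisjoint 𝒜) {f : C(KSpace 𝒜, ℝ)} (hf : f ∈ nullSubspace 𝒜)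
    {ε : ℝ} (hε : 0 < ε) : {n | ε ≤ |f (ofNat 𝒜 n)|}.Finite := by
  obtain ⟨F, -, hE⟩ := exists_finset h𝒜 f hε
  refine (hE.union (F.finite_toSet.biUnion fun A _ => finite_of_mem h𝒜 f A hε)).subset
    fun n hn => ?_
  by_cases h : ∀ A ∈ F, n ∉ (A : Set ℕ)
  · exact Or.inl ⟨h, by simpa [hf.2] using hn⟩
  · push Not at h
    obtain ⟨A, hA, h⟩ := h
    exact Or.inr (mem_biUnion hA ⟨h, by simpa [hf.1] using hn⟩)

/-- The functions on `K_𝒜` that vanish off `ω` form a copy of `c₀`. -/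
noncomputable def nullEquiv (h𝒜 : AlmostDisjoint 𝒜) : C₀(ℕ, ℝ) ≃L[ℝ] nullSubspace 𝒜 :=
  ContinuousLinearEquiv.equivOfInverse
    ((extendNull h𝒜).codRestrict (nullSubspace 𝒜) fun h => ⟨fun _ => rfl, rfl⟩)
    (LinearMap.mkContinuous
      { toFun := fun f => ZeroAtInftyContinuousMap.ofFinite (fun n => f.1 (ofNat 𝒜 n))
          fun _ hε => finite_of_null h𝒜 f.2 hε
        map_add' := fun _ _ => rfl
        map_smul' := fun _ _ => rfl } 1
      fun f => ZeroAtInftyContinuousMap.norm_le_of_forall (by positivity) fun n =>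
        (abs_apply_le f.1 (ofNat 𝒜 n)).trans_eq (one_mul _).symm)
    (fun _ => rfl)
    (fun f => by
      ext1
      rw [ext_iff']
      exact ⟨fun _ => rfl, fun A => (f.2.1 A).symm, f.2.2.symm⟩)

/-- The characteristic function of the clopen set `A ∪ {A}`. -/
noncomputable def char (h𝒜 : AlmostDisjoint 𝒜) (A : 𝒜) : C(KSpace 𝒜, ℝ) := by
  classical
  exact mk h𝒜 ((A : Set ℕ).indicator 1) (Pi.single A 1) 0
    (fun B ε hε => by
      by_cases h : B = A
      · subst h
        convert finite_empty
        ext n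
        simp only [Pi.single_eq_same, mem_ofPred_eq, mem_empty_iff_false, iff_false, not_and]
        intro hn
        simpa [hn] using hε
      · refine (h𝒜.2 B.2 A.2 fun h' => h (Subtype.ext h')).subset fun n hn => ⟨hn.1, ?_⟩
        by_contra hnA
        have := hn.2
        simp [h, hnA] at this
        linarith)
    (fun ε hε => ⟨{A}, fun B hB => by simpa [Finset.mem_singleton.not.1 hB] using hε, by
      convert finite_empty
      ext n
      simp only [Finset.mem_singleton, forall_eq, sub_zero, mem_ofPred_eq, mem_empty_iff_false,
        iff_false, not_and]
      intro hn
      simpa [hn] using hε⟩)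

section char

variable (h𝒜 : AlmostDisjoint 𝒜) (A : 𝒜)

@[simp] theorem char_nat (n : ℕ) :
    char h𝒜 A (ofNat 𝒜 n) = (A : Set ℕ).indicator (1 : ℕ → ℝ) n := rfl
@[simp] theorem char_self : char h𝒜 A (ofMem A) = 1 := by
  simp [char]
theorem char_of_ne {B : 𝒜} (h : B ≠ A) : char h𝒜 A (ofMem B) = 0 := by
  simp [char, h]
@[simp] theorem char_infty : char h𝒜 A OnePoint.infty = 0 := rfl

end char

/-- A sequence in `ω` along which all continuous functions converge to their value at a point off
`ω` yields a complemented copy of `c₀`. -/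
theorem nonempty_absorb_of_seq (h𝒜 : AlmostDisjoint 𝒜) (d : ℕ → ℕ) (hd : d.Injective)
    (x : KSpace 𝒜) (hx : ∀ f ∈ nullSubspace 𝒜, f x = 0)
    (hdx : ∀ f : C(KSpace 𝒜, ℝ), ∀ ε > 0, {i | ε ≤ |f (ofNat 𝒜 (d i)) - f x|}.Finite) :
    Nonempty (C(KSpace 𝒜, ℝ) ≃L[ℝ] C₀(ℕ, ℝ) × C(KSpace 𝒜, ℝ)) := by
  -- The operator records the deviations `f (d i) - f x`. Null sequences placed along `d` are
  -- recovered exactly, since their extensions vanish at `x`.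
  let R : C(KSpace 𝒜, ℝ) →L[ℝ] C₀(ℕ, ℝ) := LinearMap.mkContinuous
    { toFun := fun f => ZeroAtInftyContinuousMap.ofFinite _ (hdx f)
      map_add' := fun f g => by ext i; simp; ring
      map_smul' := fun c f => by ext i; simp; ring } 2
    fun f => ZeroAtInftyContinuousMap.norm_le_of_forall (by positivity) fun i => by
      refine (abs_sub _ _).trans ?_
      linarith [abs_apply_le f (ofNat 𝒜 (d i)), abs_apply_le f x]
  have hext : ∀ (h : C₀(ℕ, ℝ)) n, |Function.extend d h 0 n| ≤ ‖h‖ := by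
    intro h n
    by_cases hn : ∃ i, d i = n
    · obtain ⟨i, rfl⟩ := hn
      rw [hd.extend_apply]
      exact h.abs_apply_le i
    · rw [Function.extend_apply' _ _ _ hn]
      simp
  let E : C₀(ℕ, ℝ) →L[ℝ] C₀(ℕ, ℝ) := LinearMap.mkContinuous
    { toFun := fun h => ZeroAtInftyContinuousMap.ofFinite (Function.extend d h 0) fun ε hε => by
        refine ((h.finite_le_abs hε).image d).subset fun n hn => ?_
        by_cases hn' : ∃ i, d i = n
        · obtain ⟨i, rfl⟩ := hn'
          simp only [hd.extend_apply, mem_ofPred_eq] at hn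
          exact ⟨i, hn, rfl⟩
        · simp only [Function.extend_apply' _ _ _ hn', mem_ofPred_eq] at hn
          simp at hn
          linarith
      map_add' := fun f g => by
        ext n
        have := congrFun (Function.extend_add d f g (0 : ℕ → ℝ) 0) n
        simpa using this
      map_smul' := fun c f => by
        ext n
        have := congrFun (Function.extend_smul c d f (0 : ℕ → ℝ)) n
        simpa using this } 1
    fun f => ZeroAtInftyContinuousMap.norm_le_of_forall (by positivity) fun n =>
      (hext f n).trans_eq (one_mul _).symm
  refine nonempty_equiv_prod_of_rightInverse R ((extendNull h𝒜).comp E) fun h => ?_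
  ext i
  have h1 : R (extendNull h𝒜 (E h)) i =
      extendNull h𝒜 (E h) (ofNat 𝒜 (d i)) - extendNull h𝒜 (E h) x := rfl
  have h2 : E h (d i) = Function.extend d h 0 (d i) := rfl
  rw [ContinuousLinearMap.comp_apply, h1, hx _ ⟨fun _ => rfl, rfl⟩, extendNull_nat, h2,
    hd.extend_apply, sub_zero]

/-- The space `C(K_𝒜)` absorbs `c₀`. -/
theorem nonempty_absorb (h𝒜 : AlmostDisjoint 𝒜) :
    Nonempty (C(KSpace 𝒜, ℝ) ≃L[ℝ] C₀(ℕ, ℝ) × C(KSpace 𝒜, ℝ)) := by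
  rcases 𝒜.eq_empty_or_nonempty with h | ⟨A, hA⟩
  · refine nonempty_absorb_of_seq h𝒜 id Function.injective_id OnePoint.infty (fun f hf => hf.2)
      fun f ε hε => ?_
    obtain ⟨F, -, hE⟩ := exists_finset h𝒜 f hε
    refine hE.subset fun n hn => ⟨fun A _ => ?_, hn⟩
    have := A.2
    simp [h] at this
  · let d := (h𝒜.1 A hA).natEmbedding
    have hd : Function.Injective fun i => (d i : ℕ) := Subtype.val_injective.comp d.injective
    refine nonempty_absorb_of_seq h𝒜 _ hd (ofMem ⟨A, hA⟩) (fun f hf => hf.1 _)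
      fun f ε hε => ?_
    refine ((finite_of_mem h𝒜 f ⟨A, hA⟩ hε).preimage hd.injOn).subset fun i hi => ?_
    exact ⟨(d i).2, hi⟩

/-- The space `C(K_𝒜)` absorbs finite powers of the scalars. -/
theorem nonempty_absorb_finite (h𝒜 : AlmostDisjoint 𝒜) (α : Type) [Finite α] :
    Nonempty (C(KSpace 𝒜, ℝ) ≃L[ℝ] (α → ℝ) × C(KSpace 𝒜, ℝ)) := by
  obtain ⟨e⟩ := nonempty_absorb h𝒜
  let r := ContinuousLinearEquiv.refl ℝ
  exact ⟨e.trans ((((ZeroAtInftyContinuousMap.natProdFinite α).trans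
    (ContinuousLinearEquiv.prodComm ℝ _ _)).prodCongr (r _)).trans
    ((ContinuousLinearEquiv.prodAssoc ℝ _ _ _).trans ((r _).prodCongr e.symm)))⟩

end KSpace

/-! ### Transport along a link, and part (a) -/

namespace KSpace

variable {𝒜 ℬ : Set (Set ℕ)}

/-- If `S` links `ℬ` to `𝒜`, then averaging over `S` transports continuous functions on `K_𝒜` to
continuous functions on `K_ℬ`. -/
theorem exists_transport_of_link (h𝒜 : AlmostDisjoint 𝒜) (hℬ : AlmostDisjoint ℬ) (e : 𝒜 ≃ ℬ)
    {S : ℕ → Finset ℕ} (hS : ∀ n, (S n).card ≤ 2) (hS' : ∀ n, ∀ k ∈ S n, n ≤ k)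
    (hG : ∀ A : 𝒜, ∀ᶠ n in atTop,
      Linking.Good (fun A : 𝒜 => (A : Set ℕ)) (fun A => (e A : Set ℕ)) n (S n) A) :
    ∃ T : C(KSpace 𝒜, ℝ) →L[ℝ] C(KSpace ℬ, ℝ),
      ∀ f, (∀ A, T f (ofMem (e A)) = f (ofMem A)) ∧ T f OnePoint.infty = f OnePoint.infty := by
  classical
  -- Because the members of `S n` are at least `n`, they eventually avoid any finite exceptional
  -- set.
  have key : ∀ (f : C(KSpace 𝒜, ℝ)), ∀ ε > 0, ∀ F : Finset 𝒜,
      {n | (∀ A ∈ F, n ∉ (A : Set ℕ)) ∧ ε ≤ |f (ofNat 𝒜 n) - f OnePoint.infty|}.Finite →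
      ∀ᶠ n in atTop, ∀ k ∈ S n, (∀ A ∈ F, k ∉ (A : Set ℕ)) →
        |f (ofNat 𝒜 k) - f OnePoint.infty| < ε := by
    intro f ε hε F hF
    filter_upwards [eventually_forall_ge_atTop.2 hF.eventually_atTop_notMem] with n hn k hk hkF
    by_contra h
    exact hn k (hS' n k hk) ⟨hkF, not_lt.1 h⟩
  let u : C(KSpace 𝒜, ℝ) → ℕ → ℝ := fun f n =>
    f OnePoint.infty + ∑ k ∈ S n, (f (ofNat 𝒜 k) - f OnePoint.infty)
  have hu : ∀ f, ∀ A : 𝒜, ∀ ε > 0, {n ∈ (e A : Set ℕ) | ε ≤ |u f n - f (ofMem A)|}.Finite := by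
    intro f A ε hε
    obtain ⟨F, -, hF⟩ := exists_finset h𝒜 f (half_pos hε)
    apply Nat.finite_setOf_of_eventually
    have h1 : ∀ᶠ n in atTop, ∀ B ∈ F, B ≠ A → ¬ (n ∈ (e A : Set ℕ) ∧ n ∈ (e B : Set ℕ)) := by
      rw [Filter.eventually_all_finset]
      intro B _
      by_cases hBA : B = A
      · simp [hBA]
      · refine (hℬ.2 (e A).2 (e B).2 fun h => hBA ?_).eventually_atTop_notMem.mono fun n hn _ => hn
        exact (e.injective (Subtype.ext h)).symm
    have h2 : ∀ᶠ n in atTop, ∀ B ∈ F, Linking.Good (fun A : 𝒜 => (A : Set ℕ))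
        (fun A => (e A : Set ℕ)) n (S n) B :=
      (Filter.eventually_all_finset _).2 fun B _ => hG B
    filter_upwards [h1, h2, hG A, key f _ (half_pos hε) F hF,
      eventually_forall_ge_atTop.2 (finite_of_mem h𝒜 f A (half_pos hε)).eventually_atTop_notMem]
      with n h1 h2 h3 h4 h5
    rintro ⟨hn, hle⟩
    obtain ⟨k₀, ⟨hk₀, hk₀A⟩, huniq⟩ := h3.1 hn
    have h6 : |f (ofNat 𝒜 k₀) - f (ofMem A)| < ε / 2 := by
      by_contra h
      exact h5 k₀ (hS' n _ hk₀) ⟨hk₀A, not_lt.1 h⟩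
    -- The remaining point avoids `A` by uniqueness of `k₀`. It avoids every other member `B` of `F`
    -- because `n ∉ e B` for large `n ∈ e A`.
    have h7 : |∑ k ∈ (S n).erase k₀, (f (ofNat 𝒜 k) - f OnePoint.infty)| ≤ ε / 2 := by
      refine (Finset.abs_sum_le_sum_abs _ _).trans
        ((Finset.sum_le_card_nsmul _ _ (ε / 2) fun k hk => ?_).trans ?_)
      · obtain ⟨hne, hk⟩ := Finset.mem_erase.1 hk
        refine (h4 k hk fun B hB hkB => ?_).le
        by_cases hBA : B = A
        · subst hBA
          exact hne (huniq k ⟨hk, hkB⟩)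
        · exact (h2 B hB).2 (fun h => h1 B hB hBA ⟨hn, h⟩) k hk hkB
      · have : ((S n).erase k₀).card ≤ 1 := by
          rw [Finset.card_erase_of_mem hk₀]
          have := hS n
          omega
        rw [nsmul_eq_mul]
        have : (((S n).erase k₀).card : ℝ) ≤ 1 := by exact_mod_cast this
        nlinarith
    have h8 : u f n - f (ofMem A) = (f (ofNat 𝒜 k₀) - f (ofMem A)) +
        ∑ k ∈ (S n).erase k₀, (f (ofNat 𝒜 k) - f OnePoint.infty) := by
      simp only [u]
      rw [← Finset.add_sum_erase _ _ hk₀]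
      ring
    rw [h8] at hle
    linarith [abs_add_le (f (ofNat 𝒜 k₀) - f (ofMem A))
      (∑ k ∈ (S n).erase k₀, (f (ofNat 𝒜 k) - f OnePoint.infty))]
  have hu' : ∀ f, ∀ ε > 0, ∃ F : Finset ℬ,
      (∀ B ∉ F, |f (ofMem (e.symm B)) - f OnePoint.infty| < ε) ∧
      {n | (∀ B ∈ F, n ∉ (B : Set ℕ)) ∧ ε ≤ |u f n - f OnePoint.infty|}.Finite := by
    intro f ε hε
    have hε3 : 0 < ε / 3 := by positivity
    obtain ⟨F, hF1, hF⟩ := exists_finset h𝒜 f hε3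
    refine ⟨F.map e.toEmbedding, fun B hB => (hF1 _ fun h => hB ?_).trans (by linarith), ?_⟩
    · exact Finset.mem_map.2 ⟨_, h, by simp⟩
    apply Nat.finite_setOf_of_eventually
    have h2 : ∀ᶠ n in atTop, ∀ B ∈ F, Linking.Good (fun A : 𝒜 => (A : Set ℕ))
        (fun A => (e A : Set ℕ)) n (S n) B :=
      (Filter.eventually_all_finset _).2 fun B _ => hG B
    filter_upwards [h2, key f _ hε3 F hF] with n h2 h4
    rintro ⟨hn, hle⟩
    have h7 : |∑ k ∈ S n, (f (ofNat 𝒜 k) - f OnePoint.infty)| ≤ 2 * (ε / 3) := by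
      refine (Finset.abs_sum_le_sum_abs _ _).trans
        ((Finset.sum_le_card_nsmul _ _ (ε / 3) fun k hk => ?_).trans ?_)
      · exact (h4 k hk fun B hB => (h2 B hB).2
          (hn _ (Finset.mem_map_of_mem _ hB)) k hk).le
      · rw [nsmul_eq_mul]
        have : ((S n).card : ℝ) ≤ 2 := by exact_mod_cast hS n
        gcongr
    simp only [u, add_sub_cancel_left] at hle
    linarith
  refine ⟨LinearMap.mkContinuous
    { toFun := fun f => mk hℬ (u f) (fun B => f (ofMem (e.symm B))) (f OnePoint.infty)
        (fun B => by simpa using hu f (e.symm B)) (hu' f)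
      map_add' := fun f g => by
        rw [ext_iff']
        simp only [u, mk_nat, mk_mem, mk_infty, ContinuousMap.add_apply, implies_true, and_true]
        intro n
        rw [add_add_add_comm, ← Finset.sum_add_distrib]
        congr 1
        exact Finset.sum_congr rfl fun k _ => by ring
      map_smul' := fun c f => by
        rw [ext_iff']
        simp only [u, mk_nat, mk_mem, mk_infty, ContinuousMap.smul_apply, implies_true, and_true,
          smul_eq_mul, RingHom.id_apply, mul_add, Finset.mul_sum, mul_sub] } 5
    fun f => ?_, fun f => ⟨fun A => ?_, rfl⟩⟩
  · have hf := norm_nonneg f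
    rw [norm_le_iff]
    refine ⟨fun n => ?_, fun B => (abs_apply_le f _).trans (by linarith),
      (abs_apply_le f _).trans (by linarith)⟩
    -- At most two summands of size `2‖f‖`, together with `|f(∞)|`, account for the constant 5.
    have h1 : |∑ k ∈ S n, (f (ofNat 𝒜 k) - f OnePoint.infty)| ≤ 2 * (2 * ‖f‖) := by
      refine (Finset.abs_sum_le_sum_abs _ _).trans
        ((Finset.sum_le_card_nsmul _ _ (2 * ‖f‖) fun k hk => ?_).trans ?_)
      · refine (abs_sub _ _).trans ?_
        linarith [abs_apply_le f (ofNat 𝒜 k), abs_apply_le f OnePoint.infty]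
      · rw [nsmul_eq_mul]
        have : ((S n).card : ℝ) ≤ 2 := by exact_mod_cast hS n
        gcongr
    refine (abs_add_le _ _).trans ?_
    linarith [abs_apply_le f OnePoint.infty]
  · exact congrArg (fun A => f (ofMem A)) (e.symm_apply_apply A)

/-- Under Martin's axiom for `|𝒜|`, restrictions to the set of non-isolated points lift along any
bijection of `𝒜` with another almost disjoint family. -/
theorem exists_transport {κ : Cardinal.{0}} (hMA : MartinAxiom κ) (hκ : #𝒜 ≤ κ)
    (h𝒜 : AlmostDisjoint 𝒜) (hℬ : AlmostDisjoint ℬ) (e : 𝒜 ≃ ℬ) :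
    ∃ T : C(KSpace 𝒜, ℝ) →L[ℝ] C(KSpace ℬ, ℝ),
      ∀ f, (∀ A, T f (ofMem (e A)) = f (ofMem A)) ∧ T f OnePoint.infty = f OnePoint.infty := by
  obtain ⟨S, h1, h2, h3⟩ := hMA.exists_link (ι := 𝒜) hκ (A := fun A => A) (B := fun A => e A)
    (fun A => h𝒜.1 A A.2) (fun A B hne => h𝒜.2 A.2 B.2 fun h => hne (Subtype.ext h))
    (fun A B hne => hℬ.2 (e A).2 (e B).2 fun h => hne (e.injective (Subtype.ext h)))
  exact exists_transport_of_link h𝒜 hℬ e h1 h2 fun A => eventually_atTop.2 (h3 A)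

/-- Under Martin's axiom for `κ`, the space `C(K_𝒜)` depends only on the cardinality of `𝒜`. -/
theorem nonempty_equiv_of_mk_eq {κ : Cardinal.{0}} (hMA : MartinAxiom κ)
    (h𝒜 : AlmostDisjoint 𝒜) (hℬ : AlmostDisjoint ℬ) (h1 : #𝒜 = κ) (h2 : #ℬ = κ) :
    Nonempty (C(KSpace 𝒜, ℝ) ≃L[ℝ] C(KSpace ℬ, ℝ)) := by
  obtain ⟨e⟩ := Cardinal.eq.1 (h1.trans h2.symm)
  obtain ⟨T, hT⟩ := exists_transport hMA h1.le h𝒜 hℬ e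
  obtain ⟨T', hT'⟩ := exists_transport hMA h2.le hℬ h𝒜 e.symm
  have hT1 : ∀ f B, T f (ofMem B) = f (ofMem (e.symm B)) := fun f B => by
    simpa using (hT f).1 (e.symm B)
  have hT1' : ∀ f A, T' f (ofMem A) = f (ofMem (e A)) := fun f A => by
    simpa using (hT' f).1 (e A)
  have E := T.equivProdOfInverseMod (M := nullSubspace 𝒜) (N := nullSubspace ℬ) T'
    (fun f hf => ⟨fun B => by rw [hT1, hf.1], by rw [(hT f).2, hf.2]⟩)
    (fun f hf => ⟨fun B => by rw [hT1', hf.1], by rw [(hT' f).2, hf.2]⟩)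
    (fun f => ⟨fun A => by simp [hT1, hT1'], by simp [(hT f).2, (hT' _).2]⟩)
    (fun f => ⟨fun A => by simp [hT1, hT1'], by simp [(hT _).2, (hT' f).2]⟩)
  -- Both null subspaces are copies of `c₀`, and each space absorbs its copy.
  obtain ⟨a⟩ := nonempty_absorb h𝒜
  obtain ⟨b⟩ := nonempty_absorb hℬ
  let r := ContinuousLinearEquiv.refl ℝ
  exact ⟨a.trans ((ContinuousLinearEquiv.prodComm ℝ _ _).trans
    ((((r _).prodCongr (nullEquiv hℬ)).trans E).trans
      (((r _).prodCongr (nullEquiv h𝒜).symm).trans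
        ((ContinuousLinearEquiv.prodComm ℝ _ _).trans b.symm))))⟩

end KSpace

/-! ### The doubled family, and part (b) -/

namespace KSpace

variable {𝒜 : Set (Set ℕ)}

/-- Restriction of continuous functions on `K_𝒜` to the points off `ω`. -/
noncomputable def restrict (𝒜 : Set (Set ℕ)) : C(KSpace 𝒜, ℝ) →L[ℝ] (Option 𝒜 → ℝ) :=
  ContinuousLinearMap.pi fun o => o.elim (ContinuousMap.evalCLM ℝ OnePoint.infty)
    fun A => ContinuousMap.evalCLM ℝ (ofMem A)

/-- For finite `𝒜` the space `C(K_𝒜)` is isomorphic to `c₀`. -/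
theorem nonempty_equiv_of_finite [Finite 𝒜] (h𝒜 : AlmostDisjoint 𝒜) :
    Nonempty (C(KSpace 𝒜, ℝ) ≃L[ℝ] C₀(ℕ, ℝ)) := by
  classical
  have := Fintype.ofFinite 𝒜
  let s : (Option 𝒜 → ℝ) →ₗ[ℝ] C(KSpace 𝒜, ℝ) :=
    { toFun := fun w => w none • 1 + ∑ A : 𝒜, (w (some A) - w none) • char h𝒜 A
      map_add' := fun v w => by
        simp only [Pi.add_apply, add_smul, add_sub_add_comm, Finset.sum_add_distrib]
        abel
      map_smul' := fun c w => by
        simp only [Pi.smul_apply, smul_eq_mul, mul_smul, ← mul_sub, RingHom.id_apply, smul_add,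
          Finset.smul_sum] }
  have hs : Function.RightInverse (LinearMap.toContinuousLinearMap s) (restrict 𝒜) := by
    intro w
    ext o
    have hsw : LinearMap.toContinuousLinearMap s w =
      w none • 1 + ∑ A : 𝒜, (w (some A) - w none) • char h𝒜 A := rfl
    rw [hsw]
    rcases o with _ | A
    · simp [restrict, ContinuousMap.sum_apply]
    · have : ∑ B : 𝒜, (w (some B) - w none) * char h𝒜 B (ofMem A) = w (some A) - w none := by
        rw [Finset.sum_eq_single A (fun B _ hne => by rw [char_of_ne h𝒜 B hne.symm, mul_zero])
          (by simp), char_self, mul_one]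
      simp [restrict, ContinuousMap.sum_apply, this]
  have hker : LinearMap.ker (restrict 𝒜 : C(KSpace 𝒜, ℝ) →ₗ[ℝ] (Option 𝒜 → ℝ)) = nullSubspace 𝒜 := by
    ext f
    rw [LinearMap.mem_ker, funext_iff, mem_nullSubspace, Option.forall, and_comm]
    rfl
  have e := ContinuousLinearEquiv.equivOfRightInverse (restrict 𝒜) _ hs
  have e' : (LinearMap.ker (restrict 𝒜 : C(KSpace 𝒜, ℝ) →ₗ[ℝ] (Option 𝒜 → ℝ))) ≃L[ℝ] C₀(ℕ, ℝ) :=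
    (ContinuousLinearEquiv.ofEq _ _ hker).trans (nullEquiv h𝒜).symm
  exact ⟨e.trans (((ContinuousLinearEquiv.refl ℝ _).prodCongr e').trans
    ((ContinuousLinearEquiv.prodComm ℝ _ _).trans
      (ZeroAtInftyContinuousMap.natProdFinite (Option 𝒜)).symm))⟩

/-- A splitting of the natural numbers into two infinite sets. -/
def natPairing : ℕ ⊕ ℕ ≃ ℕ := Equiv.natSumNatEquivNat

variable (𝒜) in
/-- The member of the doubled family that corresponds to a member of one of the two copies. -/
def doubleFun (x : 𝒜 ⊕ 𝒜) : Set ℕ :=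
  natPairing '' Sum.elim (fun A : 𝒜 => Sum.inl '' (A : Set ℕ))
    (fun A : 𝒜 => Sum.inr '' (A : Set ℕ)) x

variable (𝒜) in
/-- The almost disjoint family that consists of two copies of `𝒜` on disjoint sets. -/
def double : Set (Set ℕ) := range (doubleFun 𝒜)

theorem inl_mem_doubleFun {n : ℕ} {x : 𝒜 ⊕ 𝒜} : natPairing (Sum.inl n) ∈ doubleFun 𝒜 x ↔
    ∃ A : 𝒜, x = Sum.inl A ∧ n ∈ (A : Set ℕ) := by
  rcases x with A | A <;> simp [doubleFun]

theorem inr_mem_doubleFun {n : ℕ} {x : 𝒜 ⊕ 𝒜} : natPairing (Sum.inr n) ∈ doubleFun 𝒜 x ↔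
    ∃ A : 𝒜, x = Sum.inr A ∧ n ∈ (A : Set ℕ) := by
  rcases x with A | A <;> simp [doubleFun]

theorem doubleFun_infinite (h𝒜 : AlmostDisjoint 𝒜) (x : 𝒜 ⊕ 𝒜) : (doubleFun 𝒜 x).Infinite := by
  rcases x with A | A
  · exact ((h𝒜.1 A A.2).image Sum.inl_injective.injOn).image (Equiv.injective _).injOn
  · exact ((h𝒜.1 A A.2).image Sum.inr_injective.injOn).image (Equiv.injective _).injOn

theorem doubleFun_inter (h𝒜 : AlmostDisjoint 𝒜) {x y : 𝒜 ⊕ 𝒜} (hne : x ≠ y) :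
    (doubleFun 𝒜 x ∩ doubleFun 𝒜 y).Finite := by
  rw [doubleFun, doubleFun, ← image_inter (Equiv.injective _)]
  refine Finite.image _ ?_
  rcases x with A | A <;> rcases y with B | B
  · simp only [Sum.elim_inl]
    rw [← image_inter Sum.inl_injective]
    exact (h𝒜.2 A.2 B.2 fun h => hne (by rw [Subtype.ext h])).image _
  · convert finite_empty
    ext (n | n) <;> simp
  · convert finite_empty
    ext (n | n) <;> simp
  · simp only [Sum.elim_inr]
    rw [← image_inter Sum.inr_injective]
    exact (h𝒜.2 A.2 B.2 fun h => hne (by rw [Subtype.ext h])).image _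

theorem doubleFun_injective (h𝒜 : AlmostDisjoint 𝒜) : (doubleFun 𝒜).Injective := by
  intro x y h
  by_contra hne
  have := doubleFun_inter h𝒜 hne
  rw [← h, inter_self] at this
  exact doubleFun_infinite h𝒜 x this

theorem almostDisjoint_double (h𝒜 : AlmostDisjoint 𝒜) : AlmostDisjoint (double 𝒜) := by
  constructor
  · rintro _ ⟨x, rfl⟩
    exact doubleFun_infinite h𝒜 x
  · rintro _ ⟨x, rfl⟩ _ ⟨y, rfl⟩ hne
    exact doubleFun_inter h𝒜 fun h => hne (by rw [h])

/-- The doubled family as a disjoint union. -/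
noncomputable def doubleEquiv (h𝒜 : AlmostDisjoint 𝒜) : 𝒜 ⊕ 𝒜 ≃ double 𝒜 :=
  Equiv.ofInjective _ (doubleFun_injective h𝒜)

theorem coe_doubleEquiv (h𝒜 : AlmostDisjoint 𝒜) (x : 𝒜 ⊕ 𝒜) :
    (doubleEquiv h𝒜 x : Set ℕ) = doubleFun 𝒜 x := rfl

/-- Composition of a continuous function with a map that embeds `K_𝒜` into `K_ℬ`, given on `ω` by
`j` and on `𝒜` by `s`. -/
theorem exists_pullback {ℬ : Set (Set ℕ)} (h𝒜 : AlmostDisjoint 𝒜) (hℬ : AlmostDisjoint ℬ)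
    {j : ℕ → ℕ} (hj : j.Injective) {s : 𝒜 → ℬ} (hs : s.Injective)
    (hjs : ∀ n (B : ℬ), j n ∈ (B : Set ℕ) ↔ ∃ A, B = s A ∧ n ∈ (A : Set ℕ)) :
    ∃ T : C(KSpace ℬ, ℝ) →L[ℝ] C(KSpace 𝒜, ℝ), ∀ f,
      (∀ n, T f (ofNat 𝒜 n) = f (ofNat ℬ (j n))) ∧ (∀ A, T f (ofMem A) = f (ofMem (s A))) ∧
      T f OnePoint.infty = f OnePoint.infty := by
  refine ⟨LinearMap.mkContinuous
    { toFun := fun f => mk h𝒜 (fun n => f (ofNat ℬ (j n))) (fun A => f (ofMem (s A)))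
        (f OnePoint.infty) (fun A ε hε => ?_) (fun ε hε => ?_)
      map_add' := fun _ _ => by rw [ext_iff']; simp
      map_smul' := fun _ _ => by rw [ext_iff']; simp } 1
    fun f => ?_, fun f => ⟨fun _ => rfl, fun _ => rfl, rfl⟩⟩
  · exact ((finite_of_mem hℬ f (s A) hε).preimage hj.injOn).subset fun n hn =>
      ⟨(hjs _ _).2 ⟨A, rfl, hn.1⟩, hn.2⟩
  · obtain ⟨F, hF, hE⟩ := exists_finset hℬ f hε
    refine ⟨F.preimage s hs.injOn, fun A hA => hF _ fun h => hA (Finset.mem_preimage.2 h),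
      (hE.preimage hj.injOn).subset fun n hn => ⟨fun B hB hn' => ?_, hn.2⟩⟩
    obtain ⟨A, rfl, hnA⟩ := (hjs _ _).1 hn'
    exact hn.1 A (Finset.mem_preimage.2 hB) hnA
  · rw [norm_le_iff, one_mul]
    exact ⟨fun _ => abs_apply_le f _, fun _ => abs_apply_le f _, abs_apply_le f _⟩

/-- Two functions on `K_𝒜` with the same value at `∞` can be glued to a function on the space of
the doubled family. -/
theorem exists_glue (h𝒜 : AlmostDisjoint 𝒜) (f g : C(KSpace 𝒜, ℝ))
    (hfg : f OnePoint.infty = g OnePoint.infty) :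
    ∃ h : C(KSpace (double 𝒜), ℝ),
      (∀ n, h (ofNat _ (natPairing (Sum.inl n))) = f (ofNat 𝒜 n)) ∧
      (∀ n, h (ofNat _ (natPairing (Sum.inr n))) = g (ofNat 𝒜 n)) ∧
      (∀ A, h (ofMem (doubleEquiv h𝒜 (Sum.inl A))) = f (ofMem A)) ∧
      (∀ A, h (ofMem (doubleEquiv h𝒜 (Sum.inr A))) = g (ofMem A)) ∧
      h OnePoint.infty = f OnePoint.infty := by
  classical
  let τ := natPairing
  refine ⟨mk (almostDisjoint_double h𝒜)
    (fun n => Sum.elim (fun m => f (ofNat 𝒜 m)) (fun m => g (ofNat 𝒜 m)) (τ.symm n))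
    (fun B => Sum.elim (fun A => f (ofMem A)) (fun A => g (ofMem A)) ((doubleEquiv h𝒜).symm B))
    (f OnePoint.infty) (fun B ε hε => ?_) (fun ε hε => ?_), fun n => ?_, fun n => ?_, fun A => ?_,
    fun A => ?_, rfl⟩
  · obtain ⟨x, rfl⟩ := (doubleEquiv h𝒜).surjective B
    rw [coe_doubleEquiv, Equiv.symm_apply_apply]
    rcases x with A | A
    · refine ((finite_of_mem h𝒜 f A hε).image fun n => τ (Sum.inl n)).subset fun n hn => ?_
      obtain ⟨m | m, rfl⟩ := τ.surjective n
      · obtain ⟨B, hB, hm⟩ := inl_mem_doubleFun.1 hn.1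
        cases hB
        exact ⟨m, ⟨hm, by simpa using hn.2⟩, rfl⟩
      · obtain ⟨B, hB, hm⟩ := inr_mem_doubleFun.1 hn.1
        cases hB
    · refine ((finite_of_mem h𝒜 g A hε).image fun n => τ (Sum.inr n)).subset fun n hn => ?_
      obtain ⟨m | m, rfl⟩ := τ.surjective n
      · obtain ⟨B, hB, hm⟩ := inl_mem_doubleFun.1 hn.1
        cases hB
      · obtain ⟨B, hB, hm⟩ := inr_mem_doubleFun.1 hn.1
        cases hB
        exact ⟨m, ⟨hm, by simpa using hn.2⟩, rfl⟩
  · obtain ⟨F, hF, hE⟩ := exists_finset h𝒜 f hε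
    obtain ⟨G, hG, hE'⟩ := exists_finset h𝒜 g hε
    refine ⟨(F.disjSum G).map (doubleEquiv h𝒜).toEmbedding, fun B hB => ?_,
      ((hE.image fun n => τ (Sum.inl n)).union (hE'.image fun n => τ (Sum.inr n))).subset
        fun n hn => ?_⟩
    · obtain ⟨A | A, rfl⟩ := (doubleEquiv h𝒜).surjective B
      · simpa using hF A fun h => hB (Finset.mem_map_of_mem _ (Finset.inl_mem_disjSum.2 h))
      · simpa [hfg] using hG A fun h => hB (Finset.mem_map_of_mem _ (Finset.inr_mem_disjSum.2 h))
    · obtain ⟨m | m, rfl⟩ := τ.surjective n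
      · refine Or.inl ⟨m, ⟨fun A hA hm => ?_, by
          simpa using hn.2⟩, rfl⟩
        exact hn.1 _ (Finset.mem_map_of_mem _ (Finset.inl_mem_disjSum.2 hA))
          (inl_mem_doubleFun.2 ⟨A, rfl, hm⟩)
      · refine Or.inr ⟨m, ⟨fun A hA hm => ?_, by
          simpa [hfg] using hn.2⟩, rfl⟩
        exact hn.1 _ (Finset.mem_map_of_mem _ (Finset.inr_mem_disjSum.2 hA))
          (inr_mem_doubleFun.2 ⟨A, rfl, hm⟩)
  · simp [τ]
  · simp [τ]
  · simp
  · simp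

/-- The square of `C(K_𝒜)` is isomorphic to the space of the doubled family. -/
theorem nonempty_square_equiv_double (h𝒜 : AlmostDisjoint 𝒜) :
    Nonempty ((C(KSpace 𝒜, ℝ) × C(KSpace 𝒜, ℝ)) ≃L[ℝ] C(KSpace (double 𝒜), ℝ)) := by
  have h𝒟 := almostDisjoint_double h𝒜
  obtain ⟨T₀, hT₀⟩ := exists_pullback h𝒜 h𝒟 (j := fun n => natPairing (Sum.inl n))
    ((Equiv.injective _).comp Sum.inl_injective) (s := fun A => doubleEquiv h𝒜 (Sum.inl A))
    ((Equiv.injective _).comp Sum.inl_injective) (fun n B => by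
      obtain ⟨x, rfl⟩ := (doubleEquiv h𝒜).surjective B
      rw [coe_doubleEquiv, inl_mem_doubleFun]
      simp)
  obtain ⟨T₁, hT₁⟩ := exists_pullback h𝒜 h𝒟 (j := fun n => natPairing (Sum.inr n))
    ((Equiv.injective _).comp Sum.inr_injective) (s := fun A => doubleEquiv h𝒜 (Sum.inr A))
    ((Equiv.injective _).comp Sum.inr_injective) (fun n B => by
      obtain ⟨x, rfl⟩ := (doubleEquiv h𝒜).surjective B
      rw [coe_doubleEquiv, inr_mem_doubleFun]
      simp)
  -- The two halves of a function on the doubled space share their value at `∞`. The extra scalar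
  -- shifts the second half, so that arbitrary pairs are reached; it is absorbed at the end.
  let Φ : ((Unit → ℝ) × C(KSpace (double 𝒜), ℝ)) →L[ℝ] C(KSpace 𝒜, ℝ) × C(KSpace 𝒜, ℝ) :=
    (T₀.comp (ContinuousLinearMap.snd ℝ _ _)).prod
      (T₁.comp (ContinuousLinearMap.snd ℝ _ _) +
        ((ContinuousLinearMap.proj ()).comp (ContinuousLinearMap.fst ℝ _ _)).smulRight 1)
  have hΦ : ∀ p, Φ p = (T₀ p.2, T₁ p.2 + p.1 () • 1) := fun _ => rfl
  have hinj : LinearMap.ker Φ.toLinearMap = ⊥ := by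
    rw [LinearMap.ker_eq_bot']
    rintro ⟨c, h⟩ hp
    have hp : Φ (c, h) = 0 := hp
    rw [hΦ, Prod.mk_eq_zero, ext_iff', ext_iff'] at hp
    obtain ⟨⟨h1, h2, h3⟩, g1, g2, g3⟩ := hp
    simp only [ContinuousMap.add_apply, ContinuousMap.smul_apply, ContinuousMap.one_apply,
      ContinuousMap.zero_apply, hT₀, hT₁, smul_eq_mul, mul_one] at h1 h2 h3 g1 g2 g3
    have hc : c () = 0 := by linarith
    simp only [hc, add_zero] at g1 g2
    rw [Prod.mk_eq_zero]
    refine ⟨funext fun _ => hc, ext_iff'.2 ⟨fun n => ?_, fun B => ?_, h3⟩⟩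
    · obtain ⟨m | m, rfl⟩ := natPairing.surjective n
      exacts [h1 m, g1 m]
    · obtain ⟨A | A, rfl⟩ := (doubleEquiv h𝒜).surjective B
      exacts [h2 A, g2 A]
  have hsurj : LinearMap.range Φ.toLinearMap = ⊤ := by
    rw [LinearMap.range_eq_top]
    rintro ⟨f, g⟩
    let c := g OnePoint.infty - f OnePoint.infty
    obtain ⟨h, h1, h2, h3, h4, h5⟩ := exists_glue h𝒜 f (g - c • 1) (by simp [c])
    refine ⟨(fun _ => c, h), ?_⟩
    change Φ _ = _
    rw [hΦ, Prod.mk.injEq]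
    constructor
    · rw [ext_iff']
      simp only [hT₀, h1, h3, h5, implies_true, and_self]
    · rw [ext_iff']
      simp [hT₁, h2, h4, h5, c]
  obtain ⟨a⟩ := nonempty_absorb_finite h𝒟 Unit
  exact ⟨(a.trans (ContinuousLinearEquiv.ofBijective Φ hinj hsurj)).symm⟩

/-- Under Martin's axiom for `|𝒜|`, the space `C(K_𝒜)` is isomorphic to its square. -/
theorem nonempty_equiv_square {κ : Cardinal.{0}} (hMA : MartinAxiom κ) (h𝒜 : AlmostDisjoint 𝒜)
    (h : #𝒜 = κ) : Nonempty (C(KSpace 𝒜, ℝ) ≃L[ℝ] C(KSpace 𝒜, ℝ) × C(KSpace 𝒜, ℝ)) := by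
  -- Doubling a finite nonempty family changes its size, so (a) would not apply; there `c₀ ≃ c₀ ×
  -- c₀` suffices.
  rcases finite_or_infinite 𝒜 with _ | _
  · obtain ⟨e⟩ := nonempty_equiv_of_finite h𝒜
    exact ⟨e.trans (ZeroAtInftyContinuousMap.natProdEquiv.trans (e.symm.prodCongr e.symm))⟩
  · have h2 : #(double 𝒜) = κ := by
      rw [← Cardinal.mk_congr (doubleEquiv h𝒜), Cardinal.mk_sum, Cardinal.lift_id, h,
        Cardinal.add_eq_self (h ▸ Cardinal.aleph0_le_mk 𝒜)]
    obtain ⟨e⟩ := nonempty_square_equiv_double h𝒜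
    obtain ⟨e'⟩ := nonempty_equiv_of_mk_eq hMA h𝒜 (almostDisjoint_double h𝒜) h h2
    exact ⟨e'.trans e.symm⟩

end KSpace

/-! ### Counting the functionals on `C(K_𝒜)` -/

namespace ZeroAtInftyContinuousMap

/-- The unit vectors of `c₀`. -/
noncomputable def unitVec (n : ℕ) : C₀(ℕ, ℝ) :=
  ofFinite (Pi.single n 1) fun ε hε => (finite_singleton n).subset fun i hi => by
    by_contra h
    simp only [mem_ofPred_eq, Pi.single_eq_of_ne (show i ≠ n from h), abs_zero] at hi
    linarith

theorem eq_zero_of_unitVec (θ : C₀(ℕ, ℝ) →L[ℝ] ℝ) (h : ∀ n, θ (unitVec n) = 0) : θ = 0 := by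
  ext f
  refine abs_nonpos_iff.1 (le_of_forall_pos_le_add fun ε hε => ?_)
  rw [zero_add]
  have hpos : 0 < ‖θ‖ + 1 := by positivity
  set δ := ε / (‖θ‖ + 1) with hδ
  have hδ0 : 0 < δ := div_pos hε hpos
  let F := (f.finite_le_abs hδ0).toFinset
  let g := ∑ i ∈ F, f i • unitVec i
  have hg : θ g = 0 := by simp [g, h]
  have hgi : ∀ i, g i = if i ∈ F then f i else 0 := by
    intro i
    let ev : C₀(ℕ, ℝ) →+ ℝ := ⟨⟨fun f => f i, rfl⟩, fun _ _ => rfl⟩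
    have : g i = ∑ j ∈ F, f j * (Pi.single j 1 : ℕ → ℝ) i := map_sum ev _ _
    rw [this]
    simp [Pi.single_apply]
  have hfg : ‖f - g‖ ≤ δ := norm_le_of_forall hδ0.le fun i => by
    rw [sub_apply, hgi]
    split_ifs with hi
    · simpa using hδ0.le
    · rw [sub_zero]
      exact (not_le.1 fun h => hi ((f.finite_le_abs hδ0).mem_toFinset.2 h)).le
  calc |θ f| = |θ (f - g)| := by rw [map_sub, hg, sub_zero]
    _ ≤ ‖θ‖ * ‖f - g‖ := θ.le_opNorm _
    _ ≤ (‖θ‖ + 1) * δ := by gcongr; linarith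
    _ = ε := by rw [hδ]; field_simp

end ZeroAtInftyContinuousMap

namespace KSpace

variable {𝒜 ℬ : Set (Set ℕ)}

/-- A functional that annihilates the functions vanishing off `ω` is controlled by the values off
`ω`. -/
theorem abs_le_of_comp_extendNull (h𝒜 : AlmostDisjoint 𝒜) {θ : C(KSpace 𝒜, ℝ) →L[ℝ] ℝ}
    (hθ : θ.comp (extendNull h𝒜) = 0) {g : C(KSpace 𝒜, ℝ)} {C : ℝ}
    (hg : ∀ A : 𝒜, |g (ofMem A)| ≤ C) (hg' : |g OnePoint.infty| ≤ C) : |θ g| ≤ ‖θ‖ * C := by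
  classical
  have hC : 0 ≤ C := (abs_nonneg _).trans hg'
  refine le_of_forall_pos_le_add fun ε hε => ?_
  have hpos : 0 < ‖θ‖ + 1 := by positivity
  set δ := ε / (‖θ‖ + 1) with hδ
  have hδ0 : 0 < δ := div_pos hε hpos
  have hE : {n | C + δ ≤ |g (ofNat 𝒜 n)|}.Finite := by
    obtain ⟨F, -, hE⟩ := exists_finset h𝒜 g hδ0
    refine (hE.union (F.finite_toSet.biUnion fun A _ => finite_of_mem h𝒜 g A hδ0)).subset
      fun n hn => ?_
    have hn : C + δ ≤ |g (ofNat 𝒜 n)| := hn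
    have key : ∀ a, |a| ≤ C → δ ≤ |g (ofNat 𝒜 n) - a| := fun a ha => by
      linarith [abs_sub_abs_le_abs_sub (g (ofNat 𝒜 n)) a]
    by_cases h : ∀ A ∈ F, n ∉ (A : Set ℕ)
    · exact Or.inl ⟨h, key _ hg'⟩
    · push Not at h
      obtain ⟨A, hA, h⟩ := h
      exact Or.inr (mem_biUnion hA ⟨h, key _ (hg A)⟩)
  -- Only finitely many values on `ω` exceed `C + δ` in modulus. Removing them does not change `θ
  -- g`.
  let h : C₀(ℕ, ℝ) := ZeroAtInftyContinuousMap.ofFinite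
    ({n | C + δ ≤ |g (ofNat 𝒜 n)|}.indicator fun n => g (ofNat 𝒜 n)) fun ε hε =>
      hE.subset fun n hn => by
        by_contra hn'
        simp only [mem_ofPred_eq, indicator_of_notMem hn', abs_zero] at hn
        linarith
  have hle : ‖g - extendNull h𝒜 h‖ ≤ C + δ := by
    rw [norm_le_iff]
    refine ⟨fun n => ?_, fun A => ?_, ?_⟩
    · rw [ContinuousMap.sub_apply, extendNull_nat]
      by_cases hn : n ∈ {n | C + δ ≤ |g (ofNat 𝒜 n)|}
      · simp only [h, ZeroAtInftyContinuousMap.ofFinite_apply, indicator_of_mem hn, sub_self,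
          abs_zero]
        positivity
      · simp only [h, ZeroAtInftyContinuousMap.ofFinite_apply, indicator_of_notMem hn, sub_zero]
        exact (not_le.1 hn).le
    · simpa using (hg A).trans (le_add_of_nonneg_right hδ0.le)
    · simpa using hg'.trans (le_add_of_nonneg_right hδ0.le)
  have hθh : θ (extendNull h𝒜 h) = 0 := DFunLike.congr_fun hθ h
  calc |θ g| = |θ (g - extendNull h𝒜 h)| := by rw [map_sub, hθh, sub_zero]
    _ ≤ ‖θ‖ * ‖g - extendNull h𝒜 h‖ := θ.le_opNorm _
    _ ≤ ‖θ‖ * (C + δ) := by gcongr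
    _ ≤ ‖θ‖ * C + (‖θ‖ + 1) * δ := by nlinarith
    _ = ‖θ‖ * C + ε := by rw [hδ]; field_simp

theorem sum_char_infty (h𝒜 : AlmostDisjoint 𝒜) (F : Finset 𝒜) (c : 𝒜 → ℝ) :
    (∑ A ∈ F, c A • char h𝒜 A) OnePoint.infty = 0 := by
  simp [ContinuousMap.sum_apply]

theorem sum_char_mem [DecidableEq 𝒜] (h𝒜 : AlmostDisjoint 𝒜) (F : Finset 𝒜) (c : 𝒜 → ℝ) (B : 𝒜) :
    (∑ A ∈ F, c A • char h𝒜 A) (ofMem B) = if B ∈ F then c B else 0 := by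
  have : ∀ A, char h𝒜 A (ofMem B) = if A = B then 1 else 0 := fun A => by
    split_ifs with h
    · rw [h, char_self]
    · exact char_of_ne _ _ (Ne.symm h)
  simp [ContinuousMap.sum_apply, this]

/-- Off `ω`, every continuous function is uniformly approximated by combinations of `1` and finitely
many `char h𝒜 A`, and `θ` is controlled by values off `ω`. -/
theorem eq_zero_of_char (h𝒜 : AlmostDisjoint 𝒜) {θ : C(KSpace 𝒜, ℝ) →L[ℝ] ℝ}
    (hθ : θ.comp (extendNull h𝒜) = 0) (h1 : θ 1 = 0) (hc : ∀ A, θ (char h𝒜 A) = 0) : θ = 0 := by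
  classical
  ext f
  refine abs_nonpos_iff.1 (le_of_forall_pos_le_add fun ε hε => ?_)
  rw [zero_add]
  have hpos : 0 < ‖θ‖ + 1 := by positivity
  set δ := ε / (‖θ‖ + 1) with hδ
  have hδ0 : 0 < δ := div_pos hε hpos
  obtain ⟨F, hF, -⟩ := exists_finset h𝒜 f hδ0
  let c : 𝒜 → ℝ := fun A => f (ofMem A) - f OnePoint.infty
  have hθf : θ f = θ (f - f OnePoint.infty • 1 - ∑ A ∈ F, c A • char h𝒜 A) := by
    simp [h1, hc]
  calc |θ f| ≤ ‖θ‖ * δ := by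
        rw [hθf]
        refine abs_le_of_comp_extendNull h𝒜 hθ (fun A => ?_) ?_
        · rw [ContinuousMap.sub_apply, sum_char_mem]
          split_ifs with hA
          · simpa [c] using hδ0.le
          · simpa using (hF A hA).le
        · rw [ContinuousMap.sub_apply, sum_char_infty]
          simpa using hδ0.le
    _ ≤ (‖θ‖ + 1) * δ := by gcongr; linarith
    _ = ε := by rw [hδ]; field_simp

/-- Combinations of distinct characters with coefficients `0` or `±1` are bounded by 1 off `ω`.
Choosing the signs of `θ (char h𝒜 A)` bounds every finite sum of `|θ (char h𝒜 A)|` by `‖θ‖`, as for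
a functional in `ℓ₁`. -/
theorem countable_support_char (h𝒜 : AlmostDisjoint 𝒜) {θ : C(KSpace 𝒜, ℝ) →L[ℝ] ℝ}
    (hθ : θ.comp (extendNull h𝒜) = 0) : {A | θ (char h𝒜 A) ≠ 0}.Countable := by
  classical
  have hsum : Summable fun A => |θ (char h𝒜 A)| := by
    refine summable_of_sum_le (c := ‖θ‖ * 1) (fun _ => abs_nonneg _) fun F => ?_
    let c : 𝒜 → ℝ := fun A => SignType.sign (θ (char h𝒜 A))
    have hc : ∀ A, |c A| ≤ 1 := fun A => by
      rcases lt_trichotomy (θ (char h𝒜 A)) 0 with h | h | h <;> simp [c, h]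
    have : θ (∑ A ∈ F, c A • char h𝒜 A) = ∑ A ∈ F, |θ (char h𝒜 A)| := by
      rw [map_sum]
      exact Finset.sum_congr rfl fun A _ => by simp [c]
    rw [← this]
    refine (le_abs_self _).trans (abs_le_of_comp_extendNull h𝒜 hθ (fun A => ?_) ?_)
    · rw [sum_char_mem]
      split_ifs
      · exact hc A
      · simp
    · simp [sum_char_infty]
  simpa [Function.support] using hsum.countable_support

theorem mk_le_continuum (𝒜 : Set (Set ℕ)) : #𝒜 ≤ 𝔠 :=
  (Cardinal.mk_set_le 𝒜).trans (by simp)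

/-- The dual of `C(K_𝒜)` has at most continuum many elements. -/
theorem mk_dual_le (h𝒜 : AlmostDisjoint 𝒜) : #(C(KSpace 𝒜, ℝ) →L[ℝ] ℝ) ≤ 𝔠 := by
  let N := {θ : C(KSpace 𝒜, ℝ) →L[ℝ] ℝ // θ.comp (extendNull h𝒜) = 0}
  have hN : #N ≤ 𝔠 := by
    -- A functional in `N` is coded by its value at `1` and the countable graph of its nonzero
    -- values on characters.
    let Φ : N → ℝ × {t : Set (𝒜 × ℝ) // #t ≤ ℵ₀} := fun θ =>
      (θ.1 1, ⟨(fun A => (A, θ.1 (char h𝒜 A))) '' {A | θ.1 (char h𝒜 A) ≠ 0},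
        Cardinal.mk_le_aleph0_iff.2 ((countable_support_char h𝒜 θ.2).image _)⟩)
    have hΦ : Φ.Injective := by
      have key : ∀ θ η : N, Φ θ = Φ η → ∀ A, θ.1 (char h𝒜 A) ≠ 0 →
          θ.1 (char h𝒜 A) = η.1 (char h𝒜 A) := by
        intro θ η h A hA
        have h2 := congrArg Subtype.val (congrArg Prod.snd h)
        have h3 : (A, θ.1 (char h𝒜 A)) ∈
            (fun A => (A, η.1 (char h𝒜 A))) '' {A | η.1 (char h𝒜 A) ≠ 0} :=
          h2.subset (mem_image_of_mem (fun A => (A, θ.1 (char h𝒜 A))) hA)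
        obtain ⟨B, -, hB⟩ := h3
        rw [Prod.mk.injEq] at hB
        rw [← hB.2, hB.1]
      intro θ η h
      refine Subtype.ext (sub_eq_zero.1 (eq_zero_of_char h𝒜 ?_ ?_ fun A => ?_))
      · rw [ContinuousLinearMap.sub_comp, θ.2, η.2]
        exact sub_self (0 : C₀(ℕ, ℝ) →L[ℝ] ℝ)
      · rw [_root_.sub_apply, sub_eq_zero]
        exact congrArg Prod.fst h
      · rw [_root_.sub_apply, sub_eq_zero]
        by_cases h1 : θ.1 (char h𝒜 A) = 0
        · by_cases h2 : η.1 (char h𝒜 A) = 0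
          · rw [h1, h2]
          · exact (key η θ h.symm A h2).symm
        · exact key θ η h A h1
    refine (Cardinal.mk_le_of_injective hΦ).trans ?_
    rw [Cardinal.mk_prod, Cardinal.lift_id, Cardinal.lift_id, Cardinal.mk_real]
    refine (mul_le_mul_right (Cardinal.mk_bounded_set_le (𝒜 × ℝ) ℵ₀) _).trans ?_
    have : max #(𝒜 × ℝ) ℵ₀ ≤ 𝔠 := by
      refine max_le ?_ Cardinal.aleph0_le_continuum
      rw [Cardinal.mk_prod, Cardinal.lift_id, Cardinal.lift_id, Cardinal.mk_real]
      exact (mul_le_mul_left (mk_le_continuum 𝒜) _).trans (by simp)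
    exact (mul_le_mul_right (Cardinal.power_le_power_right this) _).trans (by simp)
  let r : (C(KSpace 𝒜, ℝ) →L[ℝ] ℝ) → ℕ → ℝ := fun φ n =>
    φ (extendNull h𝒜 (ZeroAtInftyContinuousMap.unitVec n))
  have hr : ∀ φ ψ, r φ = r ψ → (φ - ψ).comp (extendNull h𝒜) = 0 := fun φ ψ h =>
    ZeroAtInftyContinuousMap.eq_zero_of_unitVec _ fun n => by
      simpa [sub_eq_zero] using congrFun h n
  have hinv : ∀ φ, r (Function.invFun r (r φ)) = r φ := fun φ =>
    Function.invFun_eq ⟨φ, rfl⟩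
  -- Each `φ` is split into a chosen functional with the same values on the unit vectors and a
  -- difference lying in `N`.
  let Ψ : (C(KSpace 𝒜, ℝ) →L[ℝ] ℝ) → (ℕ → ℝ) × N := fun φ =>
    (r φ, ⟨φ - Function.invFun r (r φ), hr _ _ (hinv φ).symm⟩)
  have hΨ : Ψ.Injective := by
    intro φ ψ h
    have h1 : r φ = r ψ := congrArg Prod.fst h
    have h2 := congrArg Subtype.val (congrArg Prod.snd h)
    simp only [Ψ, h1] at h2
    exact sub_left_injective h2
  refine (Cardinal.mk_le_of_injective hΨ).trans ?_
  rw [Cardinal.mk_prod, Cardinal.lift_id, Cardinal.lift_id]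
  exact (mul_le_mul' (by simp [Cardinal.mk_real]) hN).trans (by simp : 𝔠 * 𝔠 ≤ 𝔠)

/-! ### Recovering a family from the traces on `ω` -/

variable (𝒜) in
/-- The restrictions to `ω` of the continuous functions on `K_𝒜`. -/
def traces : Set (ℕ → ℝ) := range fun (f : C(KSpace 𝒜, ℝ)) n => f (ofNat 𝒜 n)

/-- If `D ∉ 𝒜`, a continuous function with trace the indicator of `D` vanishes at every `A`, since
`A ∩ D` is finite. It then vanishes at `∞`, since `𝒜` is infinite. So its trace is a null sequence,
which contradicts the infinitude of `D`. -/
theorem mem_of_indicator_mem_traces {D : Set ℕ} (hD : D.Infinite) (h𝒜 : AlmostDisjoint 𝒜)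
    (hinf : 𝒜.Infinite) (hD𝒜 : ∀ A ∈ 𝒜, A ≠ D → (A ∩ D).Finite)
    (h : D.indicator (1 : ℕ → ℝ) ∈ traces 𝒜) : D ∈ 𝒜 := by
  by_contra hmem
  obtain ⟨f, hf⟩ := h
  have hf : ∀ n, f (ofNat 𝒜 n) = D.indicator (1 : ℕ → ℝ) n := congrFun hf
  have h1 : ∀ A : 𝒜, f (ofMem A) = 0 := by
    intro A
    by_contra hne
    have hfin := finite_of_mem h𝒜 f A (abs_pos.2 hne)
    refine h𝒜.1 A A.2 ((hfin.union (hD𝒜 A A.2 fun h => hmem (h ▸ A.2))).subset fun n hn => ?_)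
    by_cases hnD : n ∈ D
    · exact Or.inr ⟨hn, hnD⟩
    · exact Or.inl ⟨hn, by simp [hf, hnD]⟩
  have h2 : f OnePoint.infty = 0 := by
    by_contra hne
    obtain ⟨F, hF, -⟩ := exists_finset h𝒜 f (abs_pos.2 hne)
    have := hinf.to_subtype
    obtain ⟨A, hA⟩ := Infinite.exists_notMem_finset F
    simpa [h1] using hF A hA
  refine hD ((finite_of_null h𝒜 (f := f) ⟨h1, h2⟩ one_pos).subset fun n hn => ?_)
  simp [hf, hn]

theorem subset_of_traces_subset (h𝒜 : AlmostDisjoint 𝒜) (hℬ : AlmostDisjoint ℬ)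
    (hinf : ℬ.Infinite) (hU : AlmostDisjoint (𝒜 ∪ ℬ)) (h : traces 𝒜 ⊆ traces ℬ) : 𝒜 ⊆ ℬ :=
  fun D hD => mem_of_indicator_mem_traces (h𝒜.1 D hD) hℬ hinf
    (fun _ hA hne => hU.2 (Or.inr hA) (Or.inl hD) hne) (h ⟨char h𝒜 ⟨D, hD⟩, rfl⟩)

theorem traces_eq_range {X : Type} [NormedAddCommGroup X] [NormedSpace ℝ X]
    (e : X ≃L[ℝ] C(KSpace 𝒜, ℝ)) : traces 𝒜 = range fun x n => e x (ofNat 𝒜 n) :=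
  (e.surjective.range_comp fun (f : C(KSpace 𝒜, ℝ)) n => f (ofNat 𝒜 n)).symm

/-- Among families indexed injectively, with infinite members all contained in one almost disjoint
family, at most continuum many yield a given space. -/
theorem mk_isoClass_le {I : Type} {fam : I → Set (Set ℕ)} (hfam : fam.Injective)
    {𝒟 : Set (Set ℕ)} (h𝒟 : AlmostDisjoint 𝒟) (hsub : ∀ i, fam i ⊆ 𝒟)
    (hinf : ∀ i, (fam i).Infinite) {X : Type} [NormedAddCommGroup X] [NormedSpace ℝ X]
    (hX : #(X →L[ℝ] ℝ) ≤ 𝔠) : #{i // BanachIso X C(KSpace (fam i), ℝ)} ≤ 𝔠 := by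
  have had : ∀ 𝒜, 𝒜 ⊆ 𝒟 → AlmostDisjoint 𝒜 := fun 𝒜 h =>
    ⟨fun A hA => h𝒟.1 A (h hA), h𝒟.2.mono h⟩
  let e := fun i : {i // BanachIso X C(KSpace (fam i), ℝ)} => i.2.some
  -- The evaluations at the points of `ω`, pulled back to `X`, determine the traces and hence the
  -- family.
  let Φ : {i // BanachIso X C(KSpace (fam i), ℝ)} → ℕ → (X →L[ℝ] ℝ) := fun i n =>
    (ContinuousMap.evalCLM ℝ (ofNat (fam i) n)).comp (e i : X →L[ℝ] C(KSpace (fam i), ℝ))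
  have hΦ : Φ.Injective := by
    intro i j h
    have htr : traces (fam i) = traces (fam j) := by
      rw [traces_eq_range (e i), traces_eq_range (e j)]
      congr 1
      ext x n
      exact DFunLike.congr_fun (congrFun h n) x
    have hU := had _ (union_subset (hsub i) (hsub j))
    refine Subtype.ext (hfam (subset_antisymm ?_ ?_))
    · exact subset_of_traces_subset (had _ (hsub i)) (had _ (hsub j)) (hinf j) hU htr.subset
    · exact subset_of_traces_subset (had _ (hsub j)) (had _ (hsub i)) (hinf i)
        (union_comm (fam i) _ ▸ hU) htr.symm.subset
  refine (Cardinal.mk_le_of_injective hΦ).trans ?_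
  rw [← Cardinal.power_def, Cardinal.mk_nat]
  exact (Cardinal.power_le_power_right hX).trans (by simp)

end KSpace

/-! ### Branches of the binary tree, and part (c) -/

/-- The branches of the binary tree, with the nodes coded by natural numbers. -/
def branch (x : ℕ → Bool) : Set ℕ := range fun n => Encodable.encode ((List.range n).map x)

theorem branch_infinite (x : ℕ → Bool) : (branch x).Infinite := by
  refine infinite_range_of_injective fun m n h => ?_
  simpa using congrArg List.length (Encodable.encode_injective h)

theorem branch_inter {x y : ℕ → Bool} (hne : x ≠ y) : (branch x ∩ branch y).Finite := by
  obtain ⟨k, hk⟩ := Function.ne_iff.1 hne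
  refine ((finite_Iic k).image fun n => Encodable.encode ((List.range n).map x)).subset ?_
  rintro _ ⟨⟨n, rfl⟩, ⟨m, h⟩⟩
  have h := Encodable.encode_injective h
  have hmn : m = n := by simpa using congrArg List.length h
  subst hmn
  refine ⟨m, ?_, rfl⟩
  by_contra hlt
  exact hk (List.map_inj_left.1 h k (List.mem_range.2 (not_le.1 hlt))).symm

/-- There are `2 ^ 𝔠` almost disjoint families of size `𝔠` with pairwise nonisomorphic spaces. -/
theorem exists_nonisomorphic : ∃ S : Set (Set (Set ℕ)), #S = 2 ^ 𝔠 ∧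
    (∀ 𝒜 ∈ S, AlmostDisjoint 𝒜 ∧ #𝒜 = 𝔠) ∧
    S.Pairwise fun 𝒜 ℬ => ¬ BanachIso C(KSpace 𝒜, ℝ) C(KSpace ℬ, ℝ) := by
  have hbinj : branch.Injective := fun x y h => by
    by_contra hne
    have := branch_inter hne
    rw [← h, inter_self] at this
    exact branch_infinite x this
  have hC : #(ℕ → Bool) = 𝔠 := by simp
  -- The branches are split into two halves of size `𝔠`. Every family contains the whole first half,
  -- which fixes its size at `𝔠`, and the second half encodes an arbitrary `X`.
  obtain ⟨ε⟩ : Nonempty ((ℕ → Bool) ⊕ (ℕ → Bool) ≃ (ℕ → Bool)) := Cardinal.eq.1 (by simp)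
  have hginj : (branch ∘ ε).Injective := hbinj.comp ε.injective
  let 𝒟 : Set (Set ℕ) := range branch
  have h𝒟 : AlmostDisjoint 𝒟 := by
    refine ⟨?_, ?_⟩
    · rintro _ ⟨x, rfl⟩
      exact branch_infinite x
    · rintro _ ⟨x, rfl⟩ _ ⟨y, rfl⟩ hne
      exact branch_inter fun h => hne (by rw [h])
  let fam : Set (ℕ → Bool) → Set (Set ℕ) := fun X => (branch ∘ ε) '' (range Sum.inl ∪ Sum.inr '' X)
  have hsub : ∀ X, fam X ⊆ 𝒟 := fun X => by
    rintro _ ⟨x, -, rfl⟩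
    exact ⟨_, rfl⟩
  have had : ∀ X, AlmostDisjoint (fam X) := fun X =>
    ⟨fun A hA => h𝒟.1 A (hsub X hA), h𝒟.2.mono (hsub X)⟩
  have hinj : fam.Injective := by
    intro X Y h
    have h' := hginj.image_injective h
    ext x
    have := Set.ext_iff.1 h' (Sum.inr x)
    simpa using this
  have hmk : ∀ X, #(fam X) = 𝔠 := by
    intro X
    refine le_antisymm (KSpace.mk_le_continuum _) ?_
    rw [Cardinal.mk_image_eq hginj, ← hC, ← Cardinal.mk_range_eq _ (Sum.inl_injective
      (α := ℕ → Bool) (β := ℕ → Bool))]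
    exact Cardinal.mk_le_mk_of_subset subset_union_left
  have hinf : ∀ X, (fam X).Infinite := fun X =>
    infinite_coe_iff.1 (Cardinal.aleph0_le_mk_iff.1 ((hmk X).symm ▸ Cardinal.aleph0_le_continuum))
  let s : Setoid (Set (ℕ → Bool)) :=
    { r := fun X Y => BanachIso C(KSpace (fam X), ℝ) C(KSpace (fam Y), ℝ)
      iseqv := ⟨fun _ => ⟨ContinuousLinearEquiv.refl ℝ _⟩, fun ⟨e⟩ => ⟨e.symm⟩,
        fun ⟨e⟩ ⟨e'⟩ => ⟨e.trans e'⟩⟩ }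
  have hP : #(Set (ℕ → Bool)) = 2 ^ 𝔠 := by rw [Cardinal.mk_set, hC]
  have hQ : #(Quotient s) = 2 ^ 𝔠 := by
    refine le_antisymm ((Cardinal.mk_quotient_le).trans hP.le) ?_
    -- The `2 ^ 𝔠` families are partitioned into isomorphism classes of size at most `𝔠`, so fewer
    -- than `2 ^ 𝔠` classes cannot cover them.
    have hle : (2 : Cardinal) ^ 𝔠 ≤ #(Quotient s) * 𝔠 := by
      rw [← hP, ← Cardinal.mk_congr (Equiv.sigmaFiberEquiv (Quotient.mk s)), Cardinal.mk_sigma]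
      refine (Cardinal.sum_le_sum _ (fun _ => 𝔠) fun q => ?_).trans_eq (by simp)
      refine le_trans (Cardinal.mk_le_of_injective (f := fun X => ?_) ?_)
        (KSpace.mk_isoClass_le hinj h𝒟 hsub hinf (KSpace.mk_dual_le (had q.out)))
      · exact ⟨X.1, Quotient.exact (q.out_eq.trans X.2.symm)⟩
      · intro X Y h
        exact Subtype.ext (Subtype.mk.inj h)
    by_contra hlt
    refine absurd (hle.trans (Cardinal.mul_le_max _ _)) (not_le.2 ?_)
    exact max_lt (max_lt (not_le.1 hlt) (Cardinal.cantor _))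
      (Cardinal.aleph0_lt_continuum.trans (Cardinal.cantor _))
  refine ⟨range fun q : Quotient s => fam q.out, ?_, ?_, ?_⟩
  · exact (Cardinal.mk_range_eq _ (hinj.comp Quotient.out_injective)).trans hQ
  · rintro _ ⟨q, rfl⟩
    exact ⟨had _, hmk _⟩
  · rintro _ ⟨q, rfl⟩ _ ⟨q', rfl⟩ hne h
    refine hne ?_
    have : q = q' := by
      rw [← q.out_eq, ← q'.out_eq]
      exact Quotient.sound h
    rw [this]

theorem theorem1p1 :
    -- (a)
    (∀ κ : Cardinal.{0}, MartinAxiom κ →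
      ∀ 𝒜 ℬ : Set (Set ℕ), AlmostDisjoint 𝒜 → AlmostDisjoint ℬ → #𝒜 = κ → #ℬ = κ →
        BanachIso C(KSpace 𝒜, ℝ) C(KSpace ℬ, ℝ)) ∧
    -- (b)
    (∀ κ : Cardinal.{0}, MartinAxiom κ →
      ∀ 𝒜 : Set (Set ℕ), AlmostDisjoint 𝒜 → #𝒜 = κ →
        BanachIso C(KSpace 𝒜, ℝ) (C(KSpace 𝒜, ℝ) × C(KSpace 𝒜, ℝ))) ∧
    -- (c)
    (∃ S : Set (Set (Set ℕ)), #S = 2 ^ 𝔠 ∧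
      (∀ 𝒜 ∈ S, AlmostDisjoint 𝒜 ∧ #𝒜 = 𝔠) ∧
      S.Pairwise fun 𝒜 ℬ => ¬ BanachIso C(KSpace 𝒜, ℝ) C(KSpace ℬ, ℝ)) :=
  ⟨fun _ hMA _ _ h𝒜 hℬ h1 h2 => KSpace.nonempty_equiv_of_mk_eq hMA h𝒜 hℬ h1 h2,
    fun _ hMA _ h𝒜 h => KSpace.nonempty_equiv_square hMA h𝒜 h, exists_nonisomorphic⟩
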